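/- Let $(W,S)$ be a Coxeter system ($S$ possibly infinite), let $T=\bigcup_{w\in W}wSw^{-1}$ be its set of reflections, let $\ell_T(w)$ be the least number of reflections whose product is $w$, and let $\leq_T$ be the partial order on $W$ given by $v\leq_T w \Leftrightarrow \ell_T(v)+\ell_T(v^{-1}w)=\ell_T(w)$; write $[1,w]_T=\{v\in W \mid 1\leq_T v\leq_T w\}$. A parabolic subgroup is a subgroup $wW_Iw^{-1}$ with $w\in W$, $I\subseteq S$, $W_I=\langle I\rangle$; it is called irreducible if $w,I$ can be chosen such that the Coxeter graph of $I$ is nonempty and connected. For $w\in W$ let $P(w)$, the parabolic closure of $w$, be the intersection of all parabolic subgroups containing $w$. Let $u\in W$ be an involution, meaning $u^2=1$ (the case $u=1$ is allowed, and then $k=0$ below). Then $P(u)$ is a parabolic subgroup, hence the smallest one containing $u$, and it is finite. There are an integer $k\geq 0$ and pairwise commuting involutions $u_1,\dots,u_k\in W$ such that $u=u_1u_2\cdots u_k$, each $P(u_i)$ is an irreducible parabolic subgroup, and $$P(u)=P(u_1)\times P(u_2)\times\cdots\times P(u_k)$$ as an internal direct product of subgroups. The number $k$ and the $u_i$ with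 these properties are unique up to reordering. Moreover, the poset $[1,u]_T$ is the direct product of the posets $[1,u_i]_T$: the map $(x_1,\dots,x_k)\mapsto x_1x_2\cdots x_k$ is an isomorphism of posets from $\prod_{i=1}^k[1,u_i]_T$ with the componentwise order onto $[1,u]_T$, where all intervals are ordered by $\leq_T$. -/

import Mathlib

namespace CoxeterMatrix

/-- The Coxeter graph (without labels): distinct `i`, `j` are joined when `M i j ≠ 2`. In
Mathlib's convention `M i j = 0` encodes `m(i, j) = ∞`, so such a pair is joined as well. -/
def coxeterGraph {B : Type*} (M : CoxeterMatrix B) : SimpleGraph B where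
  Adj i j := i ≠ j ∧ M i j ≠ 2
  symm := ⟨fun i j h => ⟨h.1.symm, by rw [M.symmetric]; exact h.2⟩⟩
  loopless := ⟨fun _ h => h.1 rfl⟩

end CoxeterMatrix

/-- `K` is the internal direct product of the family of subgroups `H`: different members of the
family commute elementwise, and multiplication is an isomorphism from `∏ i, H i` onto `K`. -/
def Subgroup.IsInternalDirectProduct {G ι : Type*} [Group G] [Fintype ι]
    (H : ι → Subgroup G) (K : Subgroup G) : Prop :=
  ∃ hcomm : Pairwise fun i j => ∀ x y : G, x ∈ H i → y ∈ H j → Commute x y,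
    Function.Injective (Subgroup.noncommPiCoprod hcomm) ∧
      (Subgroup.noncommPiCoprod hcomm).range = K

namespace CoxeterSystem

variable {B W : Type*} [Group W] {M : CoxeterMatrix B} (cs : CoxeterSystem M W)

/-- The standard parabolic subgroup `W_I`. -/
def standardParabolic (I : Set B) : Subgroup W :=
  Subgroup.closure (cs.simple '' I)

/-- The parabolic subgroup `w W_I w⁻¹`. -/
def conjParabolic (w : W) (I : Set B) : Subgroup W :=
  (cs.standardParabolic I).map (MulAut.conj w).toMonoidHom

def IsParabolic (P : Subgroup W) : Prop :=
  ∃ (w : W) (I : Set B), P = cs.conjParabolic w I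

/-- A parabolic subgroup is irreducible if it is of the form `w W_I w⁻¹` where the Coxeter graph
of `W_I` is connected (in particular, nonempty). -/
def IsIrreducibleParabolic (P : Subgroup W) : Prop :=
  ∃ (w : W) (I : Set B), P = cs.conjParabolic w I ∧ (M.coxeterGraph.induce I).Connected

/-- The parabolic closure `P(w)`: the intersection of all parabolic subgroups containing `w`. -/
def parabolicClosure (w : W) : Subgroup W :=
  sInf {P : Subgroup W | cs.IsParabolic P ∧ w ∈ P}

/-- The reflection length `ℓ_T`. -/
noncomputable def reflectionLength (w : W) : ℕ :=
  sInf {k : ℕ | ∃ l : List W, l.length = k ∧ (∀ t ∈ l, cs.IsReflection t) ∧ l.prod = w}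

/-- The absolute order `≤_T`. -/
def AbsLE (v w : W) : Prop :=
  cs.reflectionLength v + cs.reflectionLength (v⁻¹ * w) = cs.reflectionLength w

theorem exists_reflectionWord (w : W) : ∃ l : List W, l.length = cs.reflectionLength w ∧
    (∀ t ∈ l, cs.IsReflection t) ∧ l.prod = w := by
  refine Nat.sInf_mem
    (s := {k : ℕ | ∃ l : List W, l.length = k ∧ (∀ t ∈ l, cs.IsReflection t) ∧ l.prod = w}) ?_
  obtain ⟨ω, rfl⟩ := cs.wordProd_surjective w
  refine ⟨_, ω.map cs.simple, rfl, ?_, rfl⟩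
  intro t ht
  obtain ⟨i, -, rfl⟩ := List.mem_map.1 ht
  exact cs.isReflection_simple i

theorem reflectionLength_prod_le (l : List W) (hl : ∀ t ∈ l, cs.IsReflection t) :
    cs.reflectionLength l.prod ≤ l.length :=
  Nat.sInf_le ⟨l, rfl, hl, rfl⟩

theorem reflectionLength_one : cs.reflectionLength 1 = 0 := by
  simpa using cs.reflectionLength_prod_le [] (by simp)

theorem reflectionLength_eq_zero {w : W} (h : cs.reflectionLength w = 0) : w = 1 := by
  obtain ⟨l, hl, -, rfl⟩ := cs.exists_reflectionWord w
  rw [h, List.length_eq_zero_iff] at hl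
  simp [hl]

theorem reflectionLength_mul_le (v w : W) :
    cs.reflectionLength (v * w) ≤ cs.reflectionLength v + cs.reflectionLength w := by
  obtain ⟨l, hl, hl', hlv⟩ := cs.exists_reflectionWord v
  obtain ⟨m, hm, hm', hmw⟩ := cs.exists_reflectionWord w
  have h := cs.reflectionLength_prod_le (l ++ m) (by
    intro t ht
    rcases List.mem_append.1 ht with ht | ht
    · exact hl' t ht
    · exact hm' t ht)
  rw [List.prod_append, hlv, hmw, List.length_append] at h
  omega

theorem AbsLE.rfl (w : W) : cs.AbsLE w w := by
  simp [AbsLE, reflectionLength_one]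

theorem AbsLE.trans {v w x : W} (h₁ : cs.AbsLE v w) (h₂ : cs.AbsLE w x) : cs.AbsLE v x := by
  unfold AbsLE at *
  have h₃ := cs.reflectionLength_mul_le (v⁻¹ * w) (w⁻¹ * x)
  have h₄ := cs.reflectionLength_mul_le v (v⁻¹ * x)
  rw [show v⁻¹ * w * (w⁻¹ * x) = v⁻¹ * x by group] at h₃
  rw [mul_inv_cancel_left] at h₄
  omega

theorem AbsLE.antisymm {v w : W} (h₁ : cs.AbsLE v w) (h₂ : cs.AbsLE w v) : v = w := by
  unfold AbsLE at *
  have h : v⁻¹ * w = 1 := cs.reflectionLength_eq_zero (by omega)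
  exact inv_mul_eq_one.1 h

/-- The interval `[v, w]_T` for the absolute order. -/
def AbsInterval (v w : W) : Type _ :=
  {x : W // cs.AbsLE v x ∧ cs.AbsLE x w}

/-- `[v, w]_T` is a poset for the absolute order. -/
instance (v w : W) : PartialOrder (cs.AbsInterval v w) where
  le x y := cs.AbsLE x.1 y.1
  le_refl x := AbsLE.rfl cs x.1
  le_trans _ _ _ := AbsLE.trans cs
  le_antisymm _ _ h₁ h₂ := Subtype.ext (AbsLE.antisymm cs h₁ h₂)

/-- The family `v` consists of pairwise commuting involutions with product `u`, whose parabolic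
closures are irreducible and such that `P(u) = P(v 0) × ⋯ × P(v (k - 1))`. -/
structure IsInvolutionDecomposition (u : W) {k : ℕ} (v : Fin k → W) : Prop where
  sq_eq_one : ∀ i, v i ^ 2 = 1
  commute : ∀ i j, Commute (v i) (v j)
  prod_eq : (List.ofFn v).prod = u
  irreducible : ∀ i, cs.IsIrreducibleParabolic (cs.parabolicClosure (v i))
  directProduct :
    Subgroup.IsInternalDirectProduct (fun i => cs.parabolicClosure (v i)) (cs.parabolicClosure u)

end CoxeterSystem

/-! The proof takes place in the geometric representation, where a reflection is determined by the
line of its root. By Richardson's theorem (`exists_conj_negatesSimpleRoots`) an involution is `u = g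
w g⁻¹` with `w` in a finite `W_I` acting as `-1` on the span of the simple roots of `I`. A parabolic
subgroup containing `u` must then contain the reflection in every root `g α_i`, `i ∈ I`, so `P(u) =
g W_I g⁻¹` (`NegatesSimpleRoots.parabolicClosure_conj`); finiteness follows.

The connected components of `I` are mutually orthogonal and give the irreducible factors. The
component of `u` in each factor again acts as `-1` on its piece, so the factor is its parabolic
closure. For uniqueness, a reflection in a direct product of parabolic subgroups lies in a single
factor (`exists_mem_factor_of_isReflection`), hence so does an irreducible parabolic subgroup.

For the posets, `ℓ_T(u)` is at most the dimension of the image of `u - 1`. A dimension count then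
puts all roots of a shortest reflection factorization of `u` into that image, hence all its
reflections into `P(u)` (`mem_parabolicClosure_of_mem_reflectionWord`). Sorting these reflections by
factor makes `ℓ_T` additive over the components and splits every chain `x ≤ y ≤ u`
(`absLE_chain_iff`). -/

open Polynomial.Chebyshev in
/-- The Chebyshev values `S_{k-1}(2 cos (π / m)) = sin (k π / m) / sin (π / m)` are nonnegative for
`k ≤ m` (and for all `k` if `m = 0`, encoding `m = ∞`). -/
theorem Polynomial.Chebyshev.S_eval_two_mul_cos_pi_div_nonneg {m : ℕ} (hm : m ≠ 1) (k : ℕ)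
    (hk : m = 0 ∨ k ≤ m) : 0 ≤ (S ℝ ((k : ℤ) - 1)).eval (2 * Real.cos (Real.pi / m)) := by
  rcases eq_or_ne m 0 with rfl | h0
  -- Since `π / 0 = 0`, the argument is `2` when `m = ∞`, and `S_{k-1}(2) = k`.
  · have : (2 * Real.cos (Real.pi / (0 : ℕ))) = 2 := by simp
    rw [this, S_eval_two]
    push_cast
    simp
  · have hk : k ≤ m := hk.resolve_left h0
    have h2 : (2 : ℝ) ≤ m := by exact_mod_cast (by omega : 2 ≤ m)
    have hm0 : (0 : ℝ) < m := by linarith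
    have hkm : (k : ℝ) ≤ m := by exact_mod_cast hk
    have hs : 0 < Real.sin (Real.pi / m) := by
      apply Real.sin_pos_of_pos_of_lt_pi
      · positivity
      · rw [div_lt_iff₀ hm0]
        nlinarith [Real.pi_pos]
    have h := S_two_mul_real_cos (Real.pi / m) ((k : ℤ) - 1)
    have h' : 0 ≤ Real.sin ((((k : ℤ) - 1 : ℤ) + 1 : ℝ) * (Real.pi / m)) := by
      push_cast
      rw [sub_add_cancel]
      apply Real.sin_nonneg_of_nonneg_of_le_pi
      · positivity
      · rw [mul_div_assoc', div_le_iff₀ hm0]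
        nlinarith [Real.pi_pos]
    rw [← h] at h'
    exact nonneg_of_mul_nonneg_left h' hs

/-! ### The bilinear form and the simple reflections -/

namespace CoxeterMatrix

variable {B : Type*} (M : CoxeterMatrix B)

/-- The symmetric bilinear form of the geometric representation. -/
noncomputable def rootForm : (B →₀ ℝ) →ₗ[ℝ] (B →₀ ℝ) →ₗ[ℝ] ℝ :=
  Finsupp.linearCombination ℝ fun i =>
    -- For `M i j = 0` the entry is `-cos 0 = -1`, the usual value for `m = ∞`.
    Finsupp.linearCombination ℝ fun j => -Real.cos (Real.pi / M i j)

/-- The simple roots. -/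
noncomputable def simpleRoot (_M : CoxeterMatrix B) (i : B) : B →₀ ℝ := Finsupp.single i 1

theorem rootForm_simpleRoot (i j : B) :
    M.rootForm (M.simpleRoot i) (M.simpleRoot j) = -Real.cos (Real.pi / M i j) := by
  simp [rootForm, simpleRoot]

theorem rootForm_simpleRoot_self (i : B) :
    M.rootForm (M.simpleRoot i) (M.simpleRoot i) = 1 := by
  simp [rootForm_simpleRoot]

theorem rootForm_simpleRoot_eq_zero_iff {i j : B} :
    M.rootForm (M.simpleRoot i) (M.simpleRoot j) = 0 ↔ M i j = 2 := by
  rw [rootForm_simpleRoot, neg_eq_zero]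
  constructor
  · intro h
    have h0 : M i j ≠ 0 := by
      intro h0
      simp [h0] at h
    rcases eq_or_ne (M i j) 1 with h1 | h1
    · simp [h1] at h
    by_contra h2
    have h3 : (3 : ℝ) ≤ M i j := by exact_mod_cast (by omega : 3 ≤ M i j)
    have : 0 < Real.cos (Real.pi / M i j) := by
      apply Real.cos_pos_of_mem_Ioo
      constructor
      · have := Real.pi_pos
        have : 0 < Real.pi / M i j := by positivity
        linarith
      · rw [div_lt_iff₀ (by linarith)]
        nlinarith [Real.pi_pos]
    exact this.ne' h
  · intro h
    simp [h]

theorem linearMap_ext_simpleRoot {V : Type*} [AddCommMonoid V] [Module ℝ V]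
    {f g : (B →₀ ℝ) →ₗ[ℝ] V} (h : ∀ i, f (M.simpleRoot i) = g (M.simpleRoot i)) : f = g :=
  Finsupp.lhom_ext' fun i => LinearMap.ext_ring (h i)

theorem rootForm_comm (x y : B →₀ ℝ) : M.rootForm x y = M.rootForm y x := by
  have : M.rootForm = M.rootForm.flip := by
    refine M.linearMap_ext_simpleRoot fun i => M.linearMap_ext_simpleRoot fun j => ?_
    rw [LinearMap.flip_apply, rootForm_simpleRoot, rootForm_simpleRoot, M.symmetric]
  conv_lhs => rw [this]
  rfl

theorem simpleRoot_nonneg (i : B) : 0 ≤ M.simpleRoot i :=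
  Finsupp.single_nonneg.2 zero_le_one

theorem simpleRoot_ne_zero (i : B) : M.simpleRoot i ≠ 0 := by
  simp [simpleRoot]

/-- The simple coroots. -/
noncomputable def simpleCoroot (i : B) : Module.Dual ℝ (B →₀ ℝ) :=
  (2 : ℝ) • M.rootForm (M.simpleRoot i)

theorem simpleCoroot_apply (i : B) (v : B →₀ ℝ) :
    M.simpleCoroot i v = 2 * M.rootForm (M.simpleRoot i) v := rfl

theorem simpleCoroot_self (i : B) : M.simpleCoroot i (M.simpleRoot i) = 2 := by
  rw [simpleCoroot_apply, rootForm_simpleRoot_self, mul_one]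

/-- The reflection in a simple root. -/
noncomputable def simpleReflection (i : B) : (B →₀ ℝ) ≃ₗ[ℝ] (B →₀ ℝ) :=
  Module.reflection (M.simpleCoroot_self i)

theorem simpleReflection_apply (i : B) (v : B →₀ ℝ) :
    M.simpleReflection i v = v - (2 * M.rootForm (M.simpleRoot i) v) • M.simpleRoot i :=
  Module.reflection_apply _ _

-- Powers of a product of two reflections have coefficients that are Chebyshev values at `2 cos θ`,
-- `θ = 2π/m`. These are quotients by `sin θ`, so `m = 2`, where `θ = π`, is treated separately.
open Polynomial.Chebyshev in
theorem isLiftable_simpleReflection : M.IsLiftable M.simpleReflection := by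
  intro i j
  rcases eq_or_ne i j with rfl | hij
  · rw [M.diagonal, pow_one]
    ext1 v
    exact Module.involutive_reflection (M.simpleCoroot_self i) v
  rcases eq_or_ne (M i j) 0 with h0 | h0
  · rw [h0, pow_zero]
  have h1 : M i j ≠ 1 := M.off_diagonal i j hij
  rcases eq_or_ne (M i j) 2 with h2 | h2
  · have hz := M.rootForm_simpleRoot_eq_zero_iff.2 h2
    have hz' : M.rootForm (M.simpleRoot j) (M.simpleRoot i) = 0 := by rw [rootForm_comm, hz]
    rw [h2]
    ext1 v
    simp only [pow_two, LinearEquiv.mul_apply, simpleReflection_apply, map_sub, map_smul, hz, hz',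
      rootForm_simpleRoot_self, LinearEquiv.coe_one, id]
    module
  · have h3 : (3 : ℝ) ≤ M i j := by exact_mod_cast (by omega : 3 ≤ M i j)
    set θ : ℝ := 2 * (Real.pi / M i j) with hθ
    have hmθ : M i j * θ = 2 * Real.pi := by rw [hθ]; field_simp
    have ht : M.simpleCoroot i (M.simpleRoot j) * M.simpleCoroot j (M.simpleRoot i) - 2
        = 2 * Real.cos θ := by
      rw [simpleCoroot_apply, simpleCoroot_apply, rootForm_simpleRoot, rootForm_simpleRoot,
        M.symmetric j i, hθ, Real.cos_two_mul]
      ring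
    have hs : Real.sin θ ≠ 0 := by
      apply ne_of_gt
      apply Real.sin_pos_of_pos_of_lt_pi
      · have := Real.pi_pos
        positivity
      · rw [hθ, mul_div_assoc', div_lt_iff₀ (by linarith)]
        nlinarith [Real.pi_pos]
    have hS (n : ℤ) : (S ℝ n).eval (2 * Real.cos θ) = Real.sin ((n + 1) * θ) / Real.sin θ := by
      rw [eq_div_iff hs, S_two_mul_real_cos]
    have key := Module.reflection_mul_reflection_pow_apply (M.simpleCoroot_self i)
      (M.simpleCoroot_self j) (M i j)
    ext1 v
    refine (key v).trans ?_
    rw [ht]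
    -- For `m = 2k` the factor `S_{k-1}` vanishes because `kθ = π`; for `m = 2k + 1` the factor `S_k
    -- + S_{k-1}` vanishes because `(k+1)θ = 2π - kθ`.
    rcases Nat.even_or_odd' (M i j) with ⟨k, hk | hk⟩
    · have e1 : ((M i j : ℤ) - 2) / 2 = k - 1 := by omega
      have e2 : ((M i j : ℤ) - 1) / 2 = k - 1 := by omega
      have hz : (S ℝ ((k : ℤ) - 1)).eval (2 * Real.cos θ) = 0 := by
        rw [hS]
        have : (((k : ℤ) - 1 : ℤ) + 1 : ℝ) * θ = Real.pi := by
          push_cast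
          rw [hk] at hmθ
          push_cast at hmθ
          linarith
        rw [this, Real.sin_pi, zero_div]
      rw [e1, e2, hz]
      simp
    · have e1 : ((M i j : ℤ) - 1) / 2 = k := by omega
      have e2 : ((M i j : ℤ) - 3) / 2 = k - 1 := by omega
      have e3 : ((M i j : ℤ)) / 2 = k := by omega
      have e4 : ((M i j : ℤ) - 2) / 2 = k - 1 := by omega
      have hz : (S ℝ (k : ℤ)).eval (2 * Real.cos θ) +
          (S ℝ ((k : ℤ) - 1)).eval (2 * Real.cos θ) = 0 := by
        rw [hS, hS]
        have : (((k : ℤ) : ℝ) + 1) * θ = 2 * Real.pi - (((k : ℤ) - 1 : ℤ) + 1 : ℝ) * θ := by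
          push_cast
          rw [hk] at hmθ
          push_cast at hmθ
          linarith
        rw [this, Real.sin_two_pi_sub]
        ring
      rw [e1, e2, e3, e4, hz]
      simp

end CoxeterMatrix

/-! ### The geometric representation: descents and signs of roots -/

namespace CoxeterSystem

variable {B W : Type*} [Group W] {M : CoxeterMatrix B} (cs : CoxeterSystem M W)

/-- The geometric representation. -/
noncomputable def rep : W →* ((B →₀ ℝ) ≃ₗ[ℝ] (B →₀ ℝ)) :=
  cs.lift ⟨M.simpleReflection, M.isLiftable_simpleReflection⟩

theorem rep_simple (i : B) (v : B →₀ ℝ) : cs.rep (cs.simple i) v =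
    v - (2 * M.rootForm (M.simpleRoot i) v) • M.simpleRoot i := by
  rw [rep, lift_apply_simple, CoxeterMatrix.simpleReflection_apply]

theorem rep_mul_apply (x y : W) (v : B →₀ ℝ) : cs.rep (x * y) v = cs.rep x (cs.rep y v) := by
  rw [map_mul, LinearEquiv.mul_apply]

@[simp]
theorem rep_one_apply (v : B →₀ ℝ) : cs.rep 1 v = v := by
  rw [map_one, LinearEquiv.coe_one, id]

@[simp]
theorem rep_inv_rep (x : W) (v : B →₀ ℝ) : cs.rep x⁻¹ (cs.rep x v) = v := by
  rw [← rep_mul_apply, inv_mul_cancel, rep_one_apply]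

@[simp]
theorem rep_rep_inv (x : W) (v : B →₀ ℝ) : cs.rep x (cs.rep x⁻¹ v) = v := by
  rw [← rep_mul_apply, mul_inv_cancel, rep_one_apply]

theorem rep_simple_self (i : B) :
    cs.rep (cs.simple i) (M.simpleRoot i) = -M.simpleRoot i := by
  rw [rep_simple, M.rootForm_simpleRoot_self]
  module

theorem rootForm_rep (w : W) (x y : B →₀ ℝ) :
    M.rootForm (cs.rep w x) (cs.rep w y) = M.rootForm x y := by
  induction w using cs.simple_induction_left generalizing x y with
  | one => simp
  | mul_simple_left w i ih =>
    rw [rep_mul_apply, rep_mul_apply, ← ih x y, rep_simple, rep_simple]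
    simp only [map_sub, map_smul, LinearMap.sub_apply, LinearMap.smul_apply, smul_eq_mul,
      M.rootForm_simpleRoot_self, M.rootForm_comm _ (M.simpleRoot i)]
    ring

/-- The action of the reflection `x sᵢ x⁻¹`. -/
theorem rep_conj_simple (x : W) (i : B) (v : B →₀ ℝ) :
    cs.rep (x * cs.simple i * x⁻¹) v =
      v - (2 * M.rootForm (cs.rep x (M.simpleRoot i)) v) • cs.rep x (M.simpleRoot i) := by
  rw [rep_mul_apply, rep_mul_apply, rep_simple, map_sub, map_smul, rep_rep_inv,
    ← cs.rootForm_rep x, rep_rep_inv]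

theorem rep_simpleRoot_ne_zero (w : W) (i : B) : cs.rep w (M.simpleRoot i) ≠ 0 := by
  rw [Ne, LinearEquiv.map_eq_zero_iff]
  exact M.simpleRoot_ne_zero i

-- The coefficients obey the Chebyshev recursion. The indices are written as `(k + 1 : ℕ) - 1` to
-- match `S_eval_two_mul_cos_pi_div_nonneg`.
open Polynomial.Chebyshev in
theorem rep_alternatingWord_simpleRoot (i j : B) (k : ℕ) :
    cs.rep (cs.wordProd (alternatingWord i j k)) (M.simpleRoot i) =
      if Even k then
        (S ℝ ((k + 1 : ℕ) - 1 : ℤ)).eval (2 * Real.cos (Real.pi / M i j)) • M.simpleRoot i +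
        (S ℝ ((k : ℕ) - 1 : ℤ)).eval (2 * Real.cos (Real.pi / M i j)) • M.simpleRoot j
      else
        (S ℝ ((k : ℕ) - 1 : ℤ)).eval (2 * Real.cos (Real.pi / M i j)) • M.simpleRoot i +
        (S ℝ ((k + 1 : ℕ) - 1 : ℤ)).eval (2 * Real.cos (Real.pi / M i j)) • M.simpleRoot j := by
  induction k with
  | zero => simp [alternatingWord]
  | succ k ih =>
    have hS : (S ℝ ((k + 1 + 1 : ℕ) - 1 : ℤ)).eval (2 * Real.cos (Real.pi / M i j)) =
        2 * Real.cos (Real.pi / M i j) *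
          (S ℝ ((k + 1 : ℕ) - 1 : ℤ)).eval (2 * Real.cos (Real.pi / M i j)) -
        (S ℝ ((k : ℕ) - 1 : ℤ)).eval (2 * Real.cos (Real.pi / M i j)) := by
      have := S_add_two ℝ ((k : ℤ) - 1)
      rw [show ((k + 1 + 1 : ℕ) - 1 : ℤ) = (k : ℤ) - 1 + 2 by push_cast; ring, this,
        show ((k + 1 : ℕ) - 1 : ℤ) = (k : ℤ) - 1 + 1 by push_cast; ring]
      simp
    rw [alternatingWord_succ', wordProd_cons, rep_mul_apply, ih, hS]
    by_cases hk : Even k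
    · have hk' : ¬ Even (k + 1) := by simpa [Nat.even_add_one] using hk
      rw [if_pos hk, if_pos hk, if_neg hk', map_add, map_smul, map_smul, rep_simple_self,
        rep_simple, M.rootForm_simpleRoot, M.symmetric j i]
      module
    · have hk' : Even (k + 1) := by simpa [Nat.even_add_one] using hk
      rw [if_neg hk, if_neg hk, if_pos hk', map_add, map_smul, map_smul, rep_simple_self,
        rep_simple, M.rootForm_simpleRoot]
      module

/-- Pick a descent `j` of `w` and write `w = v d` with `d` an alternating word in `i`, `j` ending in
`j`, lengths adding and `v` shortest. By induction `v` keeps both simple roots nonnegative, and `d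
α_i` is a nonnegative combination of them. -/
theorem rep_simpleRoot_nonneg_of_not_isRightDescent {w : W} {i : B}
    (h : ¬ cs.IsRightDescent w i) : 0 ≤ cs.rep w (M.simpleRoot i) := by
  induction hn : cs.length w using Nat.strong_induction_on generalizing w i with
  | _ n ih =>
  subst hn
  rcases eq_or_ne w 1 with rfl | hw
  · simpa using M.simpleRoot_nonneg i
  obtain ⟨j, hj⟩ := cs.exists_rightDescent_of_ne_one hw
  have hij : i ≠ j := by rintro rfl; exact h hj
  let p : ℕ → Prop := fun n => ∃ (v : W) (k : ℕ), cs.length v = n ∧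
    w = v * cs.wordProd (alternatingWord i j k) ∧ cs.length w = cs.length v + k
  have hp1 : p (cs.length (w * cs.simple j)) :=
    ⟨w * cs.simple j, 1, rfl, by simp [alternatingWord], (cs.isRightDescent_iff.1 hj).symm⟩
  classical
  have hp : ∃ n, p n := ⟨_, hp1⟩
  obtain ⟨v, k, hvn, hwv, hl⟩ := Nat.find_spec hp
  have hmin : ∀ v' k', w = v' * cs.wordProd (alternatingWord i j k') →
      cs.length w = cs.length v' + k' → cs.length v ≤ cs.length v' :=
    fun v' k' h₁ h₂ => hvn.trans_le (Nat.find_min' hp ⟨v', k', rfl, h₁, h₂⟩)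
  have hlt : cs.length v < cs.length w :=
    (hvn.trans_le (Nat.find_min' hp hp1)).trans_lt hj
  have hk0 : k ≠ 0 := by omega
  -- A descent here could be moved from `v` into the alternating word, making `v` shorter.
  have hvnext : ¬ cs.IsRightDescent v (if Even k then j else i) := by
    intro hd
    have := hmin (v * cs.simple (if Even k then j else i)) (k + 1) (by
      rw [alternatingWord_succ', wordProd_cons, ← mul_assoc, simple_mul_simple_cancel_right]
      exact hwv) (by rw [cs.isRightDescent_iff] at hd; omega)
    exact absurd hd (not_lt.2 this)
  -- This is the first letter of the word; a descent there would contradict additivity of lengths.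
  have hvprev : ¬ cs.IsRightDescent v (if Even k then i else j) := by
    intro hd
    obtain ⟨k, rfl⟩ := Nat.exists_eq_succ_of_ne_zero hk0
    have e : (if Even (k + 1) then i else j) = if Even k then j else i := by
      simp only [Nat.even_add_one]
      split_ifs <;> rfl
    rw [Nat.succ_eq_add_one] at *
    rw [e] at hd
    rw [alternatingWord_succ', wordProd_cons, ← mul_assoc] at hwv
    have h₁ := cs.length_mul_le (v * cs.simple (if Even k then j else i))
      (cs.wordProd (alternatingWord i j k))
    rw [← hwv] at h₁
    have h₂ := cs.length_wordProd_le (alternatingWord i j k)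
    rw [length_alternatingWord] at h₂
    rw [cs.isRightDescent_iff] at hd
    omega
  have hvi : 0 ≤ cs.rep v (M.simpleRoot i) := by
    refine ih _ hlt ?_ rfl
    split_ifs at hvnext hvprev <;> assumption
  have hvj : 0 ≤ cs.rep v (M.simpleRoot j) := by
    refine ih _ hlt ?_ rfl
    split_ifs at hvnext hvprev <;> assumption
  -- The word is reduced, so `k ≤ m`; if `k = m`, the braid relation would let it end in `i`, making
  -- `i` a descent of `w`.
  have hkM : M i j = 0 ∨ k + 1 ≤ M i j := by
    by_contra! hcon
    obtain ⟨hM0, hMk⟩ := hcon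
    have hred : cs.length (cs.wordProd (alternatingWord i j k)) = k := by
      have h₁ := cs.length_mul_le v (cs.wordProd (alternatingWord i j k))
      rw [← hwv] at h₁
      have h₂ := cs.length_wordProd_le (alternatingWord i j k)
      rw [length_alternatingWord] at h₂
      omega
    have hkM : k = M i j := by
      by_contra hne
      refine cs.not_isReduced_alternatingWord i j hM0 (m := k) (by omega) ?_
      rw [IsReduced, hred, length_alternatingWord]
    have hb : cs.wordProd (alternatingWord i j k) = cs.wordProd (alternatingWord j i k) := by
      have := cs.wordProd_braidWord_eq i j
      rwa [braidWord, braidWord, M.symmetric j i, ← hkM] at this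
    obtain ⟨k, rfl⟩ := Nat.exists_eq_succ_of_ne_zero hk0
    rw [hb, alternatingWord_succ, wordProd_concat, ← mul_assoc] at hwv
    apply h
    have h₁ := cs.length_mul_le v (cs.wordProd (alternatingWord i j k))
    have h₂ := cs.length_wordProd_le (alternatingWord i j k)
    rw [length_alternatingWord] at h₂
    rw [IsRightDescent]
    nth_rw 1 [hwv]
    rw [simple_mul_simple_cancel_right]
    omega
  have hM1 : M i j ≠ 1 := M.off_diagonal i j hij
  have ha := Polynomial.Chebyshev.S_eval_two_mul_cos_pi_div_nonneg hM1 k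
    (hkM.imp_right fun h => by omega)
  have hb := Polynomial.Chebyshev.S_eval_two_mul_cos_pi_div_nonneg hM1 (k + 1) hkM
  rw [hwv, rep_mul_apply, rep_alternatingWord_simpleRoot]
  split_ifs
  · rw [map_add, map_smul, map_smul]
    exact add_nonneg (smul_nonneg hb hvi) (smul_nonneg ha hvj)
  · rw [map_add, map_smul, map_smul]
    exact add_nonneg (smul_nonneg ha hvi) (smul_nonneg hb hvj)

theorem rep_simpleRoot_nonpos_of_isRightDescent {w : W} {i : B}
    (h : cs.IsRightDescent w i) : cs.rep w (M.simpleRoot i) ≤ 0 := by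
  have := cs.rep_simpleRoot_nonneg_of_not_isRightDescent
    (cs.isRightDescent_iff_not_isRightDescent_mul.1 h)
  rwa [rep_mul_apply, rep_simple_self, map_neg, Left.nonneg_neg_iff] at this

theorem isRightDescent_iff_rep_nonpos {w : W} {i : B} :
    cs.IsRightDescent w i ↔ cs.rep w (M.simpleRoot i) ≤ 0 := by
  refine ⟨cs.rep_simpleRoot_nonpos_of_isRightDescent, fun h => ?_⟩
  by_contra hd
  exact cs.rep_simpleRoot_ne_zero w i
    (le_antisymm h (cs.rep_simpleRoot_nonneg_of_not_isRightDescent hd))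

theorem not_isRightDescent_iff_rep_nonneg {w : W} {i : B} :
    ¬ cs.IsRightDescent w i ↔ 0 ≤ cs.rep w (M.simpleRoot i) := by
  refine ⟨cs.rep_simpleRoot_nonneg_of_not_isRightDescent, fun h hd => ?_⟩
  exact cs.rep_simpleRoot_ne_zero w i
    (le_antisymm (cs.rep_simpleRoot_nonpos_of_isRightDescent hd) h)

theorem isLeftDescent_iff_rep_nonpos {w : W} {i : B} :
    cs.IsLeftDescent w i ↔ cs.rep w⁻¹ (M.simpleRoot i) ≤ 0 := by
  rw [← isRightDescent_iff_rep_nonpos, isRightDescent_inv_iff]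

theorem not_isLeftDescent_iff_rep_nonneg {w : W} {i : B} :
    ¬ cs.IsLeftDescent w i ↔ 0 ≤ cs.rep w⁻¹ (M.simpleRoot i) := by
  rw [← not_isRightDescent_iff_rep_nonneg, isRightDescent_inv_iff]

theorem rep_simpleRoot_nonneg_or_nonpos (w : W) (i : B) :
    0 ≤ cs.rep w (M.simpleRoot i) ∨ cs.rep w (M.simpleRoot i) ≤ 0 := by
  rw [← isRightDescent_iff_rep_nonpos, ← not_isRightDescent_iff_rep_nonneg]
  exact (em _).symm

theorem eq_one_of_forall_rep_simpleRoot_nonneg {w : W}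
    (h : ∀ i, 0 ≤ cs.rep w (M.simpleRoot i)) : w = 1 := by
  by_contra hw
  obtain ⟨i, hi⟩ := cs.exists_rightDescent_of_ne_one hw
  exact cs.not_isRightDescent_iff_rep_nonneg.2 (h i) hi

theorem rep_injective : Function.Injective cs.rep := by
  rw [injective_iff_map_eq_one]
  intro w hw
  apply cs.eq_one_of_forall_rep_simpleRoot_nonneg
  intro i
  rw [hw]
  exact M.simpleRoot_nonneg i

/-! ### Standard parabolic subgroups and the spans of their simple roots -/

theorem _root_.CoxeterMatrix.simpleRoot_mem_supported {J : Set B} {i : B} (hi : i ∈ J) :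
    M.simpleRoot i ∈ Finsupp.supported ℝ ℝ J :=
  Finsupp.single_mem_supported ℝ 1 hi

theorem _root_.CoxeterMatrix.supported_eq_span_simpleRoot (J : Set B) :
    Finsupp.supported ℝ ℝ J = Submodule.span ℝ (M.simpleRoot '' J) :=
  Finsupp.supported_eq_span_single ℝ J

theorem simple_mem_standardParabolic {J : Set B} {j : B} (hj : j ∈ J) :
    cs.simple j ∈ cs.standardParabolic J :=
  Subgroup.subset_closure ⟨j, hj, rfl⟩

theorem rep_sub_mem_supported {J : Set B} {w : W} (hw : w ∈ cs.standardParabolic J)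
    (v : B →₀ ℝ) : cs.rep w v - v ∈ Finsupp.supported ℝ ℝ J := by
  induction hw using Subgroup.closure_induction generalizing v with
  | mem x hx =>
    obtain ⟨j, hj, rfl⟩ := hx
    rw [rep_simple, sub_sub_cancel_left]
    exact neg_mem (Submodule.smul_mem _ _ (CoxeterMatrix.simpleRoot_mem_supported hj))
  | one => simp
  | mul x y _ _ hx hy =>
    rw [rep_mul_apply, ← sub_add_sub_cancel _ (cs.rep y v)]
    exact add_mem (hx _) (hy _)
  | inv x _ hx =>
    have := neg_mem (hx (cs.rep x⁻¹ v))
    rwa [rep_rep_inv, neg_sub] at this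

theorem rep_mem_supported {J : Set B} {w : W} (hw : w ∈ cs.standardParabolic J)
    {v : B →₀ ℝ} (hv : v ∈ Finsupp.supported ℝ ℝ J) :
    cs.rep w v ∈ Finsupp.supported ℝ ℝ J := by
  have := add_mem (cs.rep_sub_mem_supported hw v) hv
  rwa [sub_add_cancel] at this

/-- For `i ∉ J` the coefficient of `α_i` in `w α_i` is still `1`, so `w α_i` cannot be nonpositive.
-/
theorem mem_of_isRightDescent {J : Set B} {w : W} (hw : w ∈ cs.standardParabolic J) {i : B}
    (hi : cs.IsRightDescent w i) : i ∈ J := by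
  by_contra hiJ
  have h₁ := Finsupp.mem_supported' (M := ℝ) (R := ℝ) (s := J) _ |>.1
    (cs.rep_sub_mem_supported hw (M.simpleRoot i)) i hiJ
  have h₂ := cs.isRightDescent_iff_rep_nonpos.1 hi i
  rw [Finsupp.sub_apply, sub_eq_zero] at h₁
  rw [h₁] at h₂
  simp [CoxeterMatrix.simpleRoot] at h₂
  linarith

theorem eq_one_of_mem_standardParabolic {J : Set B} {w : W} (hw : w ∈ cs.standardParabolic J)
    (h : ∀ j ∈ J, 0 ≤ cs.rep w (M.simpleRoot j)) : w = 1 := by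
  by_contra h1
  obtain ⟨i, hi⟩ := cs.exists_rightDescent_of_ne_one h1
  exact cs.not_isRightDescent_iff_rep_nonneg.2 (h i (cs.mem_of_isRightDescent hw hi)) hi

/-- Reflections are determined by the lines they negate. -/
theorem conj_simple_eq_of_rep_eq_smul {x y : W} {i j : B} {c : ℝ}
    (h : cs.rep x (M.simpleRoot i) = c • cs.rep y (M.simpleRoot j)) :
    x * cs.simple i * x⁻¹ = y * cs.simple j * y⁻¹ := by
  apply cs.rep_injective
  ext1 v
  have hc : c * c = 1 := by
    have h₁ := cs.rootForm_rep x (M.simpleRoot i) (M.simpleRoot i)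
    rw [h] at h₁
    simpa [rootForm_rep, M.rootForm_simpleRoot_self] using h₁
  rw [rep_conj_simple, rep_conj_simple, h]
  simp only [map_smul, LinearMap.smul_apply, smul_eq_mul, smul_smul]
  congr 2
  linear_combination (2 * M.rootForm (cs.rep y (M.simpleRoot j)) v) * hc

/-- If a root lies in the span of the simple roots of `J`, its reflection lies in `W_J`. -/
theorem conj_simple_mem_standardParabolic {J : Set B} {x : W} {i : B}
    (h : cs.rep x (M.simpleRoot i) ∈ Finsupp.supported ℝ ℝ J) :
    x * cs.simple i * x⁻¹ ∈ cs.standardParabolic J := by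
  -- `y` is a shortest element of the coset `W_J x`, so `y⁻¹` keeps the simple roots of `J`
  -- nonnegative.
  obtain ⟨y, hyx, hmin⟩ : ∃ y, y * x⁻¹ ∈ cs.standardParabolic J ∧
      ∀ j ∈ J, ¬ cs.IsLeftDescent y j := by
    classical
    have hp : ∃ n, ∃ y, y * x⁻¹ ∈ cs.standardParabolic J ∧ cs.length y = n :=
      ⟨_, x, by simp [one_mem], rfl⟩
    obtain ⟨y, hy, hn⟩ := Nat.find_spec hp
    refine ⟨y, hy, fun j hj hd => ?_⟩
    refine Nat.find_min hp (hd.trans_eq hn) ⟨cs.simple j * y, ?_, rfl⟩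
    rw [mul_assoc]
    exact mul_mem (cs.simple_mem_standardParabolic hj) hy
  have hy : cs.rep y (M.simpleRoot i) ∈ Finsupp.supported ℝ ℝ J := by
    have := cs.rep_mem_supported hyx h
    rwa [← rep_mul_apply, inv_mul_cancel_right] at this
  suffices hyi : y * cs.simple i * y⁻¹ ∈ cs.standardParabolic J by
    have := mul_mem (mul_mem (inv_mem hyx) hyi) hyx
    convert this using 1
    group
  set β := cs.rep y (M.simpleRoot i) with hβ
  have hsum : M.simpleRoot i = ∑ j ∈ β.support, β j • cs.rep y⁻¹ (M.simpleRoot j) := by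
    have h₁ : β = ∑ j ∈ β.support, β j • M.simpleRoot j := by
      conv_lhs => rw [← Finsupp.sum_single β]
      simp [Finsupp.sum, CoxeterMatrix.simpleRoot]
    have h₂ := congrArg (cs.rep y⁻¹) h₁
    rw [hβ, rep_inv_rep, ← hβ] at h₂
    rw [h₂, map_sum]
    simp only [map_smul]
  have hJ : ∀ j ∈ β.support, j ∈ J := fun j hj => hy hj
  have hnn : ∀ j ∈ β.support, 0 ≤ cs.rep y⁻¹ (M.simpleRoot j) := fun j hj =>
    cs.not_isLeftDescent_iff_rep_nonneg.1 (hmin j (hJ j hj))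
  have hβ0 : 0 ≤ β := by
    refine (cs.rep_simpleRoot_nonneg_or_nonpos y i).resolve_right fun hneg => ?_
    have : M.simpleRoot i ≤ 0 := by
      rw [hsum]
      exact Finset.sum_nonpos fun j hj => smul_nonpos_of_nonpos_of_nonneg (hneg j) (hnn j hj)
    exact M.simpleRoot_ne_zero i (le_antisymm this (M.simpleRoot_nonneg i))
  obtain ⟨j, hj⟩ : β.support.Nonempty := by
    rw [Finsupp.support_nonempty_iff]
    exact cs.rep_simpleRoot_ne_zero y i
  have hjpos : 0 < β j := lt_of_le_of_ne (hβ0 j) (Finsupp.mem_support_iff.1 hj).symm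
  -- The simple root `α_i` is now a nonnegative combination of nonnegative vectors; being extremal,
  -- it is proportional to each one that occurs. Hence `y s_i y⁻¹ = s_j`.
  have hle : β j • cs.rep y⁻¹ (M.simpleRoot j) ≤ M.simpleRoot i := by
    rw [hsum]
    exact Finset.single_le_sum
      (f := fun j => β j • cs.rep y⁻¹ (M.simpleRoot j))
      (fun k hk => smul_nonneg (hβ0 k) (hnn k hk)) hj
  have hmul : cs.rep y⁻¹ (M.simpleRoot j) =
      (cs.rep y⁻¹ (M.simpleRoot j) i) • M.simpleRoot i := by
    ext k
    rcases eq_or_ne k i with rfl | hk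
    · simp [CoxeterMatrix.simpleRoot]
    · have h₁ := hle k
      have h₂ := mul_nonneg hjpos.le (hnn j hj k)
      have h₃ : M.simpleRoot i k = 0 := Finsupp.single_eq_of_ne hk
      rw [h₃] at h₁
      rw [Finsupp.smul_apply, h₃, smul_zero]
      exact (mul_eq_zero.1 (le_antisymm h₁ h₂)).resolve_left hjpos.ne'
  have hrefl : y⁻¹ * cs.simple j * y⁻¹⁻¹ = 1 * cs.simple i * 1⁻¹ :=
    cs.conj_simple_eq_of_rep_eq_smul (by rw [rep_one_apply]; exact hmul)
  have : y * cs.simple i * y⁻¹ = cs.simple j := by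
    rw [one_mul, inv_one, mul_one, inv_inv] at hrefl
    rw [← hrefl]
    group
  rw [this]
  exact cs.simple_mem_standardParabolic (hJ j hj)

theorem exists_reduced_word_of_mem_standardParabolic {J : Set B} {w : W}
    (hw : w ∈ cs.standardParabolic J) :
    ∃ ω : List J, ω.length = cs.length w ∧ cs.wordProd (ω.map (↑)) = w := by
  induction hn : cs.length w generalizing w with
  | zero =>
    rw [length_eq_zero_iff] at hn
    exact ⟨[], rfl, by simp [hn]⟩
  | succ n ih =>
    have h1 : w ≠ 1 := by
      rintro rfl
      simp at hn
    obtain ⟨i, hi⟩ := cs.exists_rightDescent_of_ne_one h1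
    have hiJ := cs.mem_of_isRightDescent hw hi
    obtain ⟨ω, hω, hω'⟩ := ih (mul_mem hw (cs.simple_mem_standardParabolic hiJ)) (by
      rw [isRightDescent_iff] at hi
      omega)
    refine ⟨ω.concat ⟨i, hiJ⟩, by simp [hω], ?_⟩
    rw [List.concat_eq_append, List.map_append, wordProd_append, hω']
    simp

theorem finite_standardParabolic_of_length_le {J : Set B} (hJ : J.Finite) (n : ℕ)
    (h : ∀ w ∈ cs.standardParabolic J, cs.length w ≤ n) : Finite (cs.standardParabolic J) := by
  have := hJ.to_subtype
  have hfin : ((fun ω : List J => cs.wordProd (ω.map (↑))) '' {ω | ω.length ≤ n}).Finite :=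
    (List.finite_length_le J n).image _
  refine (hfin.subset ?_).to_subtype
  intro w hw
  obtain ⟨ω, hω, rfl⟩ := cs.exists_reduced_word_of_mem_standardParabolic hw
  exact ⟨ω, hω.trans_le (h _ hw), rfl⟩

theorem wordProd_mem_standardParabolic (ω : List B) :
    cs.wordProd ω ∈ cs.standardParabolic {i | i ∈ ω} := by
  refine list_prod_mem fun x hx => ?_
  obtain ⟨i, hi, rfl⟩ := List.mem_map.1 hx
  exact cs.simple_mem_standardParabolic hi

theorem finite_setOf_isRightDescent (w : W) : {i | cs.IsRightDescent w i}.Finite := by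
  obtain ⟨ω, rfl⟩ := cs.wordProd_surjective w
  exact (List.finite_toSet ω).subset fun i hi =>
    cs.mem_of_isRightDescent (cs.wordProd_mem_standardParabolic ω) hi

/-! ### Elements acting as `-1`, and Richardson's theorem -/

/-- `w` acts as `-1` on the span of the simple roots of `I`. -/
def NegatesSimpleRoots (w : W) (I : Set B) : Prop :=
  ∀ i ∈ I, cs.rep w (M.simpleRoot i) = -M.simpleRoot i

variable {cs}

theorem NegatesSimpleRoots.rep_eq_neg {w : W} {I : Set B} (h : cs.NegatesSimpleRoots w I)
    {v : B →₀ ℝ} (hv : v ∈ Finsupp.supported ℝ ℝ I) : cs.rep w v = -v := by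
  rw [CoxeterMatrix.supported_eq_span_simpleRoot (M := M)] at hv
  have : Set.EqOn (cs.rep w).toLinearMap (-LinearMap.id : (B →₀ ℝ) →ₗ[ℝ] _)
      (M.simpleRoot '' I) := by
    rintro _ ⟨i, hi, rfl⟩
    exact h i hi
  exact LinearMap.eqOn_span this hv

/-- Since `u` reverses the sign of `x⁻¹ α_i`, ascents of `x` are descents of `u x⁻¹`: each letter
that lengthens `x` shortens `u x⁻¹`. In particular lengths on `W_I` are bounded by that of `u`,
which makes `W_I` finite for finite `I`. -/
theorem NegatesSimpleRoots.length_mul_inv_add {u x : W} {I : Set B}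
    (h : cs.NegatesSimpleRoots u I) (hx : x ∈ cs.standardParabolic I) :
    cs.length (u * x⁻¹) + cs.length x = cs.length u := by
  have key : ∀ x ∈ cs.standardParabolic I, ∀ i ∈ I,
      (cs.length (u * x⁻¹) + cs.length x = cs.length u) →
      cs.length (u * (cs.simple i * x)⁻¹) + cs.length (cs.simple i * x) = cs.length u := by
    intro x hx i hi ih
    rw [mul_inv_rev, inv_simple, ← mul_assoc]
    have hv : cs.rep (u * x⁻¹) (M.simpleRoot i) = -cs.rep x⁻¹ (M.simpleRoot i) := by
      rw [rep_mul_apply]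
      exact h.rep_eq_neg
        (cs.rep_mem_supported (inv_mem hx) (CoxeterMatrix.simpleRoot_mem_supported hi))
    by_cases hd : cs.IsLeftDescent x i
    · have h₁ : ¬ cs.IsRightDescent (u * x⁻¹) i := by
        rw [not_isRightDescent_iff_rep_nonneg, hv, Left.nonneg_neg_iff]
        exact cs.isLeftDescent_iff_rep_nonpos.1 hd
      rw [isLeftDescent_iff] at hd
      rw [not_isRightDescent_iff] at h₁
      omega
    · have h₁ : cs.IsRightDescent (u * x⁻¹) i := by
        rw [isRightDescent_iff_rep_nonpos, hv, Left.neg_nonpos_iff]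
        exact cs.not_isLeftDescent_iff_rep_nonneg.1 hd
      rw [not_isLeftDescent_iff] at hd
      rw [isRightDescent_iff] at h₁
      omega
  induction hx using Subgroup.closure_induction_left with
  | one => simp
  | mul_left s hs y hy ih =>
    obtain ⟨i, hi, rfl⟩ := hs
    exact key y hy i hi ih
  | inv_mul_cancel s hs y hy ih =>
    obtain ⟨i, hi, rfl⟩ := hs
    rw [inv_simple]
    exact key y hy i hi ih

/-- An involution negating all simple roots that it makes negative is the longest element of a
finite standard parabolic subgroup. -/
theorem NegatesSimpleRoots.mem_standardParabolic {u : W} (hu : u⁻¹ = u)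
    (h : cs.NegatesSimpleRoots u {i | cs.IsRightDescent u i}) :
    u ∈ cs.standardParabolic {i | cs.IsRightDescent u i} := by
  set I := {i | cs.IsRightDescent u i} with hI
  obtain ⟨x, hx, hmin⟩ : ∃ x ∈ cs.standardParabolic I, ∀ z ∈ cs.standardParabolic I,
      cs.length (u * x⁻¹) ≤ cs.length (u * z⁻¹) := by
    classical
    have hp : ∃ n, ∃ x ∈ cs.standardParabolic I, cs.length (u * x⁻¹) = n :=
      ⟨_, 1, one_mem _, rfl⟩
    obtain ⟨x, hx, hn⟩ := Nat.find_spec hp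
    exact ⟨x, hx, fun z hz => hn.trans_le (Nat.find_min' hp ⟨z, hz, rfl⟩)⟩
  suffices hy : u * x⁻¹ = 1 by rwa [mul_inv_eq_one.1 hy]
  by_contra hy
  obtain ⟨j, hj⟩ := cs.exists_leftDescent_of_ne_one hy
  have hlen := h.length_mul_inv_add hx
  have hjI : j ∈ I := by
    rw [hI, Set.mem_ofPred_eq, ← hu, isRightDescent_inv_iff, IsLeftDescent]
    have := cs.length_mul_le (cs.simple j * (u * x⁻¹)) x
    rw [show cs.simple j * (u * x⁻¹) * x = cs.simple j * u by group] at this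
    rw [IsLeftDescent] at hj
    omega
  -- `(u x⁻¹)⁻¹ α_j = x u α_j = -x α_j` is nonpositive, so `x s_j` is longer than `x` and `u (x
  -- s_j)⁻¹` shorter than the minimal `u x⁻¹`.
  have hneg := cs.isLeftDescent_iff_rep_nonpos.1 hj
  rw [mul_inv_rev, inv_inv, hu, rep_mul_apply, h j hjI, map_neg, Left.neg_nonpos_iff,
    ← not_isRightDescent_iff_rep_nonneg, not_isRightDescent_iff] at hneg
  have hxj := mul_mem hx (cs.simple_mem_standardParabolic hjI)
  have h₁ := h.length_mul_inv_add hxj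
  have h₂ := hmin _ hxj
  omega

variable (cs)

/-- Richardson's theorem: every involution is conjugate to one acting as `-1` on the span of the
simple roots of a finite standard parabolic subgroup containing it. -/
theorem exists_conj_negatesSimpleRoots {u : W} (hu : u ^ 2 = 1) :
    ∃ (g w : W) (I : Set B), u = g * w * g⁻¹ ∧ I.Finite ∧ Finite (cs.standardParabolic I) ∧
      w ∈ cs.standardParabolic I ∧ cs.NegatesSimpleRoots w I := by
  induction hn : cs.length u using Nat.strong_induction_on generalizing u with
  | _ n ih =>
  subst hn
  have huu : u * u = 1 := by rw [← pow_two, hu]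
  have hinv : u⁻¹ = u := inv_eq_of_mul_eq_one_right huu
  by_cases hI : cs.NegatesSimpleRoots u {i | cs.IsRightDescent u i}
  · have hfin := cs.finite_setOf_isRightDescent u
    refine ⟨1, u, _, by simp, hfin, ?_, hI.mem_standardParabolic hinv, hI⟩
    refine cs.finite_standardParabolic_of_length_le hfin (cs.length u) fun x hx => ?_
    have := hI.length_mul_inv_add hx
    omega
  · simp only [NegatesSimpleRoots, not_forall, Set.mem_ofPred_eq] at hI
    obtain ⟨i, hi, hne⟩ := hI
    have hlt : cs.length (cs.simple i * u * cs.simple i) < cs.length u := by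
      -- If conjugation does not shorten `u`, then `u α_i ≤ 0 ≤ s_i u α_i`. These vectors differ
      -- only in the coordinate `i`, so `u α_i` is a multiple of `α_i`, and invariance of the form
      -- leaves only `-α_i`.
      by_contra! hge
      have hd : ¬ cs.IsLeftDescent (u * cs.simple i) i := by
        rw [IsLeftDescent, ← mul_assoc]
        rw [isRightDescent_iff] at hi
        omega
      rw [not_isLeftDescent_iff_rep_nonneg, mul_inv_rev, inv_simple, hinv, rep_mul_apply,
        rep_simple] at hd
      have hneg := cs.isRightDescent_iff_rep_nonpos.1 hi
      obtain ⟨c, hc⟩ : ∃ c : ℝ, cs.rep u (M.simpleRoot i) = c • M.simpleRoot i := by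
        refine ⟨cs.rep u (M.simpleRoot i) i, ?_⟩
        ext k
        rcases eq_or_ne k i with rfl | hk
        · simp [CoxeterMatrix.simpleRoot]
        · have h₁ := hneg k
          have h₂ := hd k
          have h₃ : M.simpleRoot i k = 0 := Finsupp.single_eq_of_ne hk
          rw [Finsupp.sub_apply, Finsupp.smul_apply, h₃, smul_zero, sub_zero] at h₂
          rw [Finsupp.smul_apply, h₃, smul_zero]
          exact le_antisymm h₁ h₂
      have hcc : c * c = 1 := by
        have := cs.rootForm_rep u (M.simpleRoot i) (M.simpleRoot i)
        rw [hc] at this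
        simpa [M.rootForm_simpleRoot_self] using this
      have hc0 : c ≤ 0 := by
        have := hneg i
        rw [hc] at this
        simpa [CoxeterMatrix.simpleRoot] using this
      have hc1 : c = -1 := by nlinarith
      exact hne (by rw [hc, hc1, neg_one_smul])
    have hu' : (cs.simple i * u * cs.simple i) ^ 2 = 1 := by
      rw [pow_two]
      calc _ = cs.simple i * u * (cs.simple i * cs.simple i) * u * cs.simple i := by group
        _ = cs.simple i * (u * u) * cs.simple i := by
          rw [simple_mul_simple_self]
          group
        _ = 1 := by rw [huu, mul_one, simple_mul_simple_self]
    obtain ⟨g, w, I, h₁, h₂⟩ := ih _ hlt hu' rfl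
    refine ⟨cs.simple i * g, w, I, ?_, h₂⟩
    have : u = cs.simple i * (cs.simple i * u * cs.simple i) * (cs.simple i)⁻¹ := by
      rw [inv_simple]
      simp [mul_assoc]
    rw [this, h₁]
    group

/-! ### The parabolic closure of an involution -/

theorem mem_conjParabolic {w x : W} {I : Set B} :
    x ∈ cs.conjParabolic w I ↔ w⁻¹ * x * w ∈ cs.standardParabolic I := by
  rw [conjParabolic, Subgroup.mem_map]
  constructor
  · rintro ⟨y, hy, rfl⟩
    convert! hy using 1
    simp only [MulEquiv.toMonoidHom_eq_coe, MonoidHom.coe_coe, MulAut.conj_apply]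
    group
  · intro h
    refine ⟨_, h, ?_⟩
    simp only [MulEquiv.toMonoidHom_eq_coe, MonoidHom.coe_coe, MulAut.conj_apply]
    group

theorem conj_mem_conjParabolic {w x : W} {I : Set B} :
    w * x * w⁻¹ ∈ cs.conjParabolic w I ↔ x ∈ cs.standardParabolic I := by
  rw [mem_conjParabolic]
  group

theorem conjParabolic_le_iff {w : W} {I : Set B} {H : Subgroup W} :
    cs.conjParabolic w I ≤ H ↔ ∀ i ∈ I, w * cs.simple i * w⁻¹ ∈ H := by
  rw [conjParabolic, standardParabolic, Subgroup.map_le_iff_le_comap, Subgroup.closure_le,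
    Set.image_subset_iff]
  rfl

theorem mem_parabolicClosure (w : W) : w ∈ cs.parabolicClosure w :=
  Subgroup.mem_sInf.2 fun _ h => h.2

-- If `x W_J x⁻¹` contains `g w g⁻¹`, the conjugate of the latter by `x⁻¹` lies in `W_J` and negates
-- `x⁻¹ g α_i`. An element of `W_J` moves vectors only by the span of `J`, so this root lies in that
-- span and its reflection in `W_J`.
variable {cs} in
theorem NegatesSimpleRoots.parabolicClosure_conj {g w : W} {I : Set B}
    (hw : w ∈ cs.standardParabolic I) (h : cs.NegatesSimpleRoots w I) :
    cs.parabolicClosure (g * w * g⁻¹) = cs.conjParabolic g I := by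
  refine le_antisymm (sInf_le ⟨⟨g, I, rfl⟩, cs.conj_mem_conjParabolic.2 hw⟩) (le_sInf ?_)
  rintro _ ⟨⟨x, J, rfl⟩, hx⟩
  rw [conjParabolic_le_iff]
  intro i hi
  rw [mem_conjParabolic] at hx ⊢
  have hroot : cs.rep (x⁻¹ * g) (M.simpleRoot i) ∈ Finsupp.supported ℝ ℝ J := by
    have h₁ := cs.rep_sub_mem_supported hx (cs.rep (x⁻¹ * g) (M.simpleRoot i))
    rw [← rep_mul_apply, show x⁻¹ * (g * w * g⁻¹) * x * (x⁻¹ * g) = x⁻¹ * g * w by group,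
      rep_mul_apply, h i hi, map_neg] at h₁
    have h₂ := Submodule.smul_mem _ (-1 / 2 : ℝ) h₁
    convert h₂ using 1
    module
  have := cs.conj_simple_mem_standardParabolic hroot
  convert this using 1
  group

/-! ### The reflection length of an involution -/

/-- The image of `w - 1` in the geometric representation. -/
noncomputable def movedSpace (w : W) : Submodule ℝ (B →₀ ℝ) :=
  LinearMap.range ((cs.rep w).toLinearMap - LinearMap.id)

theorem rep_sub_mem_movedSpace (w : W) (v : B →₀ ℝ) : cs.rep w v - v ∈ cs.movedSpace w :=
  ⟨v, rfl⟩

theorem movedSpace_le_iff {w : W} {U : Submodule ℝ (B →₀ ℝ)} :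
    cs.movedSpace w ≤ U ↔ ∀ v, cs.rep w v - v ∈ U := by
  rw [movedSpace, LinearMap.range_le_iff_comap, Submodule.eq_top_iff']
  rfl

theorem movedSpace_conj (g w : W) :
    cs.movedSpace (g * w * g⁻¹) = (cs.movedSpace w).map (cs.rep g).toLinearMap := by
  apply le_antisymm
  · rw [movedSpace_le_iff]
    intro v
    refine ⟨_, cs.rep_sub_mem_movedSpace w (cs.rep g⁻¹ v), ?_⟩
    simp
  · rw [Submodule.map_le_iff_le_comap, movedSpace_le_iff]
    intro v
    have := cs.rep_sub_mem_movedSpace (g * w * g⁻¹) (cs.rep g v)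
    simpa [rep_mul_apply] using this

variable {cs} in
theorem NegatesSimpleRoots.movedSpace_eq {w : W} {I : Set B}
    (hw : w ∈ cs.standardParabolic I) (h : cs.NegatesSimpleRoots w I) :
    cs.movedSpace w = Finsupp.supported ℝ ℝ I := by
  apply le_antisymm
  · rw [movedSpace_le_iff]
    exact cs.rep_sub_mem_supported hw
  · intro v hv
    have := Submodule.smul_mem _ (-1 / 2 : ℝ) (cs.rep_sub_mem_movedSpace w v)
    rw [h.rep_eq_neg hv] at this
    convert this using 1
    module

theorem reflectionLength_conj_le (g w : W) :
    cs.reflectionLength (g * w * g⁻¹) ≤ cs.reflectionLength w := by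
  obtain ⟨l, hl, hr, rfl⟩ := cs.exists_reflectionWord w
  have h₁ := cs.reflectionLength_prod_le (l.map (MulAut.conj g)) (by
    intro t ht
    obtain ⟨r, hr', rfl⟩ := List.mem_map.1 ht
    exact (hr r hr').conj g)
  rwa [← map_list_prod, List.length_map, hl] at h₁

/-- Induction on the dimension: after conjugation, multiplying by some `s_i` with `i ∈ I` gives an
involution with strictly smaller moved space. -/
theorem reflectionLength_le_finrank_movedSpace {u : W} (hu : u ^ 2 = 1) :
    cs.reflectionLength u ≤ Module.finrank ℝ (cs.movedSpace u) := by
  induction hn : Module.finrank ℝ (cs.movedSpace u) using Nat.strong_induction_on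
    generalizing u with
  | _ n ih =>
  subst hn
  obtain ⟨g, w, I, rfl, hI, -, hw, hneg⟩ := cs.exists_conj_negatesSimpleRoots hu
  refine (cs.reflectionLength_conj_le g w).trans ?_
  have hww : w * w = 1 := by
    have : g * (w * w) * g⁻¹ = 1 := by
      rw [← hu, pow_two]
      group
    rwa [conj_eq_one_iff] at this
  have hrank : Module.finrank ℝ (cs.movedSpace (g * w * g⁻¹)) =
      Module.finrank ℝ (cs.movedSpace w) := by
    rw [movedSpace_conj]
    exact LinearEquiv.finrank_map_eq (cs.rep g) _
  rw [hrank] at ih ⊢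
  rcases I.eq_empty_or_nonempty with rfl | ⟨i, hi⟩
  · rw [standardParabolic, Set.image_empty, Subgroup.closure_empty, Subgroup.mem_bot] at hw
    rw [hw, reflectionLength_one]
    exact Nat.zero_le _
  have hcomm : w * cs.simple i * w⁻¹ = cs.simple i := by
    have := cs.conj_simple_eq_of_rep_eq_smul (x := w) (y := 1) (i := i) (j := i) (c := -1)
      (by rw [hneg i hi, rep_one_apply, neg_one_smul])
    simpa using this
  have hcomm' : w * cs.simple i = cs.simple i * w := mul_inv_eq_iff_eq_mul.1 hcomm
  have hsq : (w * cs.simple i) ^ 2 = 1 := by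
    rw [pow_two]
    nth_rw 1 [hcomm']
    rw [mul_assoc, ← mul_assoc w, hww, one_mul, simple_mul_simple_self]
  have hmem : w * cs.simple i ∈ cs.standardParabolic I :=
    mul_mem hw (cs.simple_mem_standardParabolic hi)
  have hfix : cs.rep (w * cs.simple i)⁻¹ (M.simpleRoot i) = M.simpleRoot i := by
    rw [inv_eq_of_mul_eq_one_right ((pow_two _).symm.trans hsq), rep_mul_apply, rep_simple_self,
      map_neg, hneg i hi, neg_neg]
  -- As `w s_i` fixes `α_i` and preserves the form, its moved space is orthogonal to `α_i`, so it
  -- misses `α_i`, which has norm `1`.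
  have horth : ∀ v ∈ cs.movedSpace (w * cs.simple i), M.rootForm (M.simpleRoot i) v = 0 := by
    rintro _ ⟨v, rfl⟩
    change M.rootForm (M.simpleRoot i) (cs.rep (w * cs.simple i) v - v) = 0
    rw [map_sub, ← cs.rootForm_rep (w * cs.simple i)⁻¹ _ (cs.rep _ v), rep_inv_rep, hfix, sub_self]
  have hlt : cs.movedSpace (w * cs.simple i) < cs.movedSpace w := by
    rw [hneg.movedSpace_eq hw]
    refine lt_of_le_of_ne (cs.movedSpace_le_iff.2 (cs.rep_sub_mem_supported hmem)) fun he => ?_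
    have := horth (M.simpleRoot i) (by
      rw [he]
      exact CoxeterMatrix.simpleRoot_mem_supported hi)
    rw [M.rootForm_simpleRoot_self] at this
    exact one_ne_zero this
  have : FiniteDimensional ℝ (cs.movedSpace w) := by
    rw [hneg.movedSpace_eq hw, CoxeterMatrix.supported_eq_span_simpleRoot (M := M)]
    exact FiniteDimensional.span_of_finite ℝ (hI.image _)
  have hlt' := Submodule.finrank_lt_finrank_of_lt hlt
  have h₁ := ih _ hlt' hsq rfl
  have h₂ := cs.reflectionLength_mul_le (w * cs.simple i) (cs.simple i)
  have h₃ := cs.reflectionLength_prod_le [cs.simple i] (by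
    simpa using cs.isReflection_simple i)
  rw [simple_mul_simple_cancel_right] at h₂
  rw [List.prod_singleton, List.length_singleton] at h₃
  omega

/-- Each reflection changes a vector by a multiple of its root, so the roots of the factors span a
space containing the moved space of the product. -/
theorem exists_roots_of_reflections (l : List W) (hl : ∀ t ∈ l, cs.IsReflection t) :
    ∃ r : List (B →₀ ℝ), r.length = l.length ∧
      cs.movedSpace l.prod ≤ Submodule.span ℝ {x | x ∈ r} ∧
      ∀ t ∈ l, ∃ x i, t = x * cs.simple i * x⁻¹ ∧ cs.rep x (M.simpleRoot i) ∈ r := by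
  induction l with
  | nil => exact ⟨[], rfl, cs.movedSpace_le_iff.2 (by simp), by simp⟩
  | cons t l ih =>
    obtain ⟨r, hr, hle, hroots⟩ := ih fun s hs => hl s (List.mem_cons_of_mem _ hs)
    obtain ⟨x, i, rfl⟩ := hl t List.mem_cons_self
    refine ⟨cs.rep x (M.simpleRoot i) :: r, by simp [hr], ?_, ?_⟩
    · rw [movedSpace_le_iff] at hle ⊢
      intro v
      rw [List.prod_cons, rep_mul_apply, rep_conj_simple, sub_right_comm]
      refine sub_mem (Submodule.span_mono ?_ (hle v))
        (Submodule.smul_mem _ _ (Submodule.subset_span List.mem_cons_self))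
      intro y hy
      exact List.mem_cons_of_mem _ hy
    · intro s hs
      rcases List.mem_cons.1 hs with rfl | hs
      · exact ⟨x, i, rfl, List.mem_cons_self⟩
      · obtain ⟨y, j, h₁, h₂⟩ := hroots s hs
        exact ⟨y, j, h₁, List.mem_cons_of_mem _ h₂⟩

/-- The reflections in a shortest reflection factorization of an involution `u` lie in `P(u)`. -/
theorem mem_parabolicClosure_of_mem_reflectionWord {u : W} (hu : u ^ 2 = 1) {l : List W}
    (hl : ∀ t ∈ l, cs.IsReflection t) (hprod : l.prod = u)
    (hlen : l.length = cs.reflectionLength u) {t : W} (ht : t ∈ l) :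
    t ∈ cs.parabolicClosure u := by
  obtain ⟨r, hr, hle, hroots⟩ := cs.exists_roots_of_reflections l hl
  obtain ⟨x, i, rfl, hx⟩ := hroots t ht
  rw [hprod] at hle
  classical
  have hfin : {x | x ∈ r} = (r.toFinset : Set (B →₀ ℝ)) := by
    ext
    simp
  rw [hfin] at hle
  -- At most `ℓ_T(u)` roots span a space containing the moved space, whose dimension is at least
  -- `ℓ_T(u)`; so the two spaces agree and every root is in the moved space.
  have hspan : Module.finrank ℝ (Submodule.span ℝ (r.toFinset : Set (B →₀ ℝ))) ≤
      Module.finrank ℝ (cs.movedSpace u) :=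
    (finrank_span_finset_le_card _).trans <| (List.toFinset_card_le r).trans <|
      (hr.trans hlen).trans_le (cs.reflectionLength_le_finrank_movedSpace hu)
  have heq := Submodule.eq_of_le_of_finrank_le hle hspan
  have hmem : cs.rep x (M.simpleRoot i) ∈ cs.movedSpace u := by
    rw [heq]
    exact Submodule.subset_span (by simpa using hx)
  obtain ⟨g, w, I, rfl, -, -, hw, hneg⟩ := cs.exists_conj_negatesSimpleRoots hu
  rw [hneg.parabolicClosure_conj hw, mem_conjParabolic]
  rw [movedSpace_conj, hneg.movedSpace_eq hw] at hmem
  obtain ⟨v, hv, hvx⟩ := hmem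
  have hgx : cs.rep (g⁻¹ * x) (M.simpleRoot i) ∈ Finsupp.supported ℝ ℝ I := by
    rw [rep_mul_apply, ← hvx]
    simpa using hv
  have := cs.conj_simple_mem_standardParabolic hgx
  convert this using 1
  group

end CoxeterSystem

/-! ### Components in internal direct products -/

namespace Subgroup.IsInternalDirectProduct

variable {G : Type*} [Group G] {k : ℕ} {H : Fin k → Subgroup G} {K : Subgroup G}

/-- List products carry no commutativity proof, so components can be handled as plain functions into
`G`. -/
theorem _root_.Subgroup.noncommPiCoprod_eq_prod_ofFn
    (hcomm : Pairwise fun i j => ∀ x y : G, x ∈ H i → y ∈ H j → Commute x y) (f : ∀ i, H i) :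
    Subgroup.noncommPiCoprod hcomm f = (List.ofFn fun i => (f i : G)).prod := by
  rw [Subgroup.noncommPiCoprod_apply, List.ofFn_eq_map]
  simp only [← List.toFinset_finRange]
  rw [Finset.noncommProd_toFinset _ _ _ (List.nodup_finRange k)]

theorem commute (h : IsInternalDirectProduct H K) {i j : Fin k} (hij : i ≠ j) {x y : G}
    (hx : x ∈ H i) (hy : y ∈ H j) : Commute x y :=
  h.1 hij x y hx hy

theorem iSup_eq (h : IsInternalDirectProduct H K) : ⨆ i, H i = K := by
  obtain ⟨hcomm, -, hr⟩ := h
  rw [← hr, Subgroup.noncommPiCoprod_range]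

theorem le (h : IsInternalDirectProduct H K) (i : Fin k) : H i ≤ K :=
  h.iSup_eq ▸ le_iSup H i

theorem exists_prod_eq (h : IsInternalDirectProduct H K) {x : G} (hx : x ∈ K) :
    ∃ f : Fin k → G, (∀ i, f i ∈ H i) ∧ (List.ofFn f).prod = x := by
  obtain ⟨hcomm, -, hr⟩ := h
  rw [← hr] at hx
  obtain ⟨f, rfl⟩ := hx
  exact ⟨fun i => f i, fun i => (f i).2, (noncommPiCoprod_eq_prod_ofFn hcomm f).symm⟩

theorem prod_injective (h : IsInternalDirectProduct H K) {f f' : Fin k → G}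
    (hf : ∀ i, f i ∈ H i) (hf' : ∀ i, f' i ∈ H i)
    (he : (List.ofFn f).prod = (List.ofFn f').prod) : f = f' := by
  obtain ⟨hcomm, hinj, -⟩ := h
  have := @hinj (fun i => ⟨f i, hf i⟩) (fun i => ⟨f' i, hf' i⟩) (by
    rwa [noncommPiCoprod_eq_prod_ofFn, noncommPiCoprod_eq_prod_ofFn])
  funext i
  exact congrArg Subtype.val (congrFun this i)

theorem prod_mul (h : IsInternalDirectProduct H K) {f f' : Fin k → G}
    (hf : ∀ i, f i ∈ H i) (hf' : ∀ i, f' i ∈ H i) :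
    (List.ofFn fun i => f i * f' i).prod = (List.ofFn f).prod * (List.ofFn f').prod := by
  have := map_mul (Subgroup.noncommPiCoprod h.1) (fun i => ⟨f i, hf i⟩) (fun i => ⟨f' i, hf' i⟩)
  rw [noncommPiCoprod_eq_prod_ofFn, noncommPiCoprod_eq_prod_ofFn,
    noncommPiCoprod_eq_prod_ofFn] at this
  exact this

theorem prod_inv (h : IsInternalDirectProduct H K) {f : Fin k → G} (hf : ∀ i, f i ∈ H i) :
    (List.ofFn fun i => (f i)⁻¹).prod = (List.ofFn f).prod⁻¹ := by
  have := map_inv (Subgroup.noncommPiCoprod h.1) (fun i => ⟨f i, hf i⟩)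
  rw [noncommPiCoprod_eq_prod_ofFn, noncommPiCoprod_eq_prod_ofFn] at this
  exact this

theorem prod_mulSingle (h : IsInternalDirectProduct H K) {i : Fin k} {x : G} (hx : x ∈ H i) :
    (List.ofFn (Pi.mulSingle i x)).prod = x := by
  have := Subgroup.noncommPiCoprod_mulSingle (hcomm := h.1) i ⟨x, hx⟩
  rw [noncommPiCoprod_eq_prod_ofFn] at this
  convert this using 3
  funext j
  rcases eq_or_ne j i with rfl | hj
  · simp
  · simp [hj]

theorem mulSingle_mem {i : Fin k} {x : G} (hx : x ∈ H i) (j : Fin k) :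
    (Pi.mulSingle i x : Fin k → G) j ∈ H j := by
  rcases eq_or_ne j i with rfl | hj
  · simpa using hx
  · simp [hj]

/-- Isolating one component lets the remaining factors be treated together, for instance when they
all fix a root. -/
theorem _root_.Subgroup.exists_prod_ofFn_eq_mul
    (hcomm : Pairwise fun i j => ∀ x y : G, x ∈ H i → y ∈ H j → Commute x y)
    {f : Fin k → G} (hf : ∀ i, f i ∈ H i) (i : Fin k) :
    ∃ y ∈ ⨆ j, ⨆ _ : j ≠ i, H j, (List.ofFn f).prod = f i * y := by
  let F : ∀ i, H i := fun i => ⟨f i, hf i⟩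
  have hF : F = Pi.mulSingle i (F i) * Function.update F i 1 := by
    funext j
    rcases eq_or_ne j i with rfl | hj
    · simp
    · simp [hj]
  have h := congrArg (Subgroup.noncommPiCoprod hcomm) hF
  rw [map_mul, Subgroup.noncommPiCoprod_mulSingle, noncommPiCoprod_eq_prod_ofFn] at h
  refine ⟨_, ?_, h⟩
  rw [Subgroup.noncommPiCoprod_apply]
  refine Subgroup.noncommProd_mem _ _ fun j _ => ?_
  rcases eq_or_ne j i with rfl | hj
  · simp [one_mem]
  · rw [Function.update_of_ne hj]
    exact (le_iSup₂_of_le (f := fun j (_ : j ≠ i) => H j) j hj le_rfl) (hf j)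

theorem disjoint_iSup (h : IsInternalDirectProduct H K) (i : Fin k) :
    Disjoint (H i) (⨆ j, ⨆ _ : j ≠ i, H j) := by
  obtain ⟨hcomm, hinj, -⟩ := h
  rw [Subgroup.disjoint_def]
  intro x hx hx'
  -- The other factors lie in the image of the tuples with trivial `i`-th entry; injectivity then
  -- forces `x = 1`.
  have hle : ⨆ j, ⨆ _ : j ≠ i, H j ≤
      (Pi.evalMonoidHom (fun i => H i) i).ker.map (Subgroup.noncommPiCoprod hcomm) := by
    refine iSup₂_le fun j hj y hy => ?_
    refine ⟨Pi.mulSingle j ⟨y, hy⟩, ?_, Subgroup.noncommPiCoprod_mulSingle j ⟨y, hy⟩⟩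
    rw [SetLike.mem_coe, MonoidHom.mem_ker, Pi.evalMonoidHom_apply, Pi.mulSingle_eq_of_ne hj.symm]
  obtain ⟨f, hf, hfx⟩ := hle hx'
  have he : f = Pi.mulSingle i ⟨x, hx⟩ :=
    hinj (hfx.trans (Subgroup.noncommPiCoprod_mulSingle i ⟨x, hx⟩).symm)
  rw [SetLike.mem_coe, MonoidHom.mem_ker, Pi.evalMonoidHom_apply, he, Pi.mulSingle_eq_same] at hf
  exact congrArg Subtype.val hf

theorem eq_one_of_mem_of_mem (h : IsInternalDirectProduct H K) {i j : Fin k} (hij : i ≠ j) {x : G}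
    (hi : x ∈ H i) (hj : x ∈ H j) : x = 1 :=
  Subgroup.disjoint_def.1 (h.disjoint_iSup i) hi
    ((le_iSup₂_of_le (f := fun j (_ : j ≠ i) => H j) j hij.symm le_rfl) hj)

/-- Components are determined by the factor they lie in, independently of the indexing. -/
theorem component_unique {l : ℕ} {H' : Fin l → Subgroup G} (h : IsInternalDirectProduct H K)
    (h' : IsInternalDirectProduct H' K) (σ : Fin k ≃ Fin l) (hσ : ∀ i, H i = H' (σ i))
    {f : Fin k → G} {f' : Fin l → G} (hf : ∀ i, f i ∈ H i) (hf' : ∀ i, f' i ∈ H' i)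
    (he : (List.ofFn f).prod = (List.ofFn f').prod) (i : Fin k) : f i = f' (σ i) := by
  obtain ⟨y, hy, hfy⟩ := exists_prod_ofFn_eq_mul h.1 hf i
  obtain ⟨y', hy', hfy'⟩ := exists_prod_ofFn_eq_mul h'.1 hf' (σ i)
  have hle : ⨆ j, ⨆ _ : j ≠ σ i, H' j ≤ ⨆ j, ⨆ _ : j ≠ i, H j := by
    refine iSup₂_le fun j hj => ?_
    obtain ⟨j, rfl⟩ := σ.surjective j
    rw [← hσ]
    exact le_iSup₂_of_le (f := fun j (_ : j ≠ i) => H j) j (by rintro rfl; exact hj rfl) le_rfl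
  have heq : (f' (σ i))⁻¹ * f i = y' * y⁻¹ := by
    rw [eq_mul_inv_iff_mul_eq, mul_assoc, inv_mul_eq_iff_eq_mul, ← hfy, ← hfy', he]
  have := Subgroup.disjoint_def.1 (h.disjoint_iSup i)
    (mul_mem (inv_mem (hσ i ▸ hf' (σ i))) (hf i))
    (by rw [heq]; exact mul_mem (hle hy') (inv_mem hy))
  exact (inv_mul_eq_one.1 this).symm

end Subgroup.IsInternalDirectProduct

/-! ### Reflections in direct products of parabolic subgroups -/

namespace CoxeterSystem

variable {B W : Type*} [Group W] {M : CoxeterMatrix B} (cs : CoxeterSystem M W)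

/-- The subgroup of elements fixing `v` in the geometric representation. -/
noncomputable def fixer (v : B →₀ ℝ) : Subgroup W where
  carrier := {w | cs.rep w v = v}
  one_mem' := cs.rep_one_apply v
  mul_mem' {x y} hx hy := by
    change cs.rep (x * y) v = v
    rw [rep_mul_apply]
    exact (congrArg (cs.rep x) hy).trans hx
  inv_mem' {x} hx := by
    change cs.rep x⁻¹ v = v
    exact (congrArg (cs.rep x⁻¹) hx).symm.trans (cs.rep_inv_rep x v)

theorem mem_fixer {v : B →₀ ℝ} {w : W} : w ∈ cs.fixer v ↔ cs.rep w v = v := Iff.rfl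

theorem IsReflection.ne_one {cs : CoxeterSystem M W} {t : W} (ht : cs.IsReflection t) : t ≠ 1 := by
  rintro rfl
  simpa using ht.odd_length

theorem conj_mem_conjParabolic_of_mem {g : W} {I : Set B} {i : B} (hi : i ∈ I) :
    g * cs.simple i * g⁻¹ ∈ cs.conjParabolic g I :=
  cs.conj_mem_conjParabolic.2 (cs.simple_mem_standardParabolic hi)

/-- Distinct commuting reflections have orthogonal roots. -/
theorem rep_conj_simple_eq_self_of_commute {x y : W} {i j : B}
    (hc : Commute (x * cs.simple i * x⁻¹) (y * cs.simple j * y⁻¹))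
    (hne : x * cs.simple i * x⁻¹ ≠ y * cs.simple j * y⁻¹) :
    cs.rep (x * cs.simple i * x⁻¹) (cs.rep y (M.simpleRoot j)) = cs.rep y (M.simpleRoot j) := by
  set γ := cs.rep y (M.simpleRoot j) with hγ
  set δ := cs.rep x (M.simpleRoot i) with hδ
  rw [rep_conj_simple, ← hδ, sub_eq_self]
  by_contra hb
  have hb0 : M.rootForm δ γ ≠ 0 := by
    intro h0
    simp [h0] at hb
  -- With `b` the product of `δ` and `γ`, the two sides are `-γ + 2bδ` and `-γ - 2bδ + 4b²γ`, so `δ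
  -- = bγ` and the reflections coincide.
  have h1 : cs.rep (x * cs.simple i * x⁻¹) (cs.rep (y * cs.simple j * y⁻¹) γ) =
      cs.rep (y * cs.simple j * y⁻¹) (cs.rep (x * cs.simple i * x⁻¹) γ) := by
    rw [← rep_mul_apply, hc.eq, rep_mul_apply]
  have hγγ : M.rootForm γ γ = 1 := by rw [hγ, rootForm_rep, M.rootForm_simpleRoot_self]
  simp only [rep_conj_simple, ← hδ, ← hγ] at h1
  simp only [map_sub, map_smul, smul_eq_mul, hγγ, M.rootForm_comm γ δ] at h1
  refine hne (cs.conj_simple_eq_of_rep_eq_smul (c := M.rootForm δ γ) ?_)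
  rw [← hγ, ← hδ]
  have h2 : (4 * M.rootForm δ γ) • δ = (4 * M.rootForm δ γ) • (M.rootForm δ γ • γ) := by
    linear_combination (norm := module) h1
  exact smul_right_injective _ (mul_ne_zero four_ne_zero hb0) h2

/-- With `b` the value of the form on `α_i`, `α_j`, the two products send `α_j` to vectors with
`α_i`-coefficients `2b` and `-2b`, so `b = 0`. -/
theorem eq_two_of_commute_simple {i j : B} (hij : i ≠ j)
    (h : Commute (cs.simple i) (cs.simple j)) : M i j = 2 := by
  rw [← M.rootForm_simpleRoot_eq_zero_iff]
  have h1 : cs.rep (cs.simple i * cs.simple j) (M.simpleRoot j) =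
      cs.rep (cs.simple j * cs.simple i) (M.simpleRoot j) := by rw [h.eq]
  have h2 : M.simpleRoot i i = 1 := Finsupp.single_eq_same
  have h3 : M.simpleRoot j i = 0 := Finsupp.single_eq_of_ne hij
  have h4 := DFunLike.congr_fun h1 i
  simp only [rep_mul_apply, rep_simple, map_sub, map_smul, smul_eq_mul, Finsupp.sub_apply,
    Finsupp.smul_apply, h2, h3, M.rootForm_simpleRoot_self] at h4
  linarith

/-- A reflection in an internal direct product of parabolic subgroups lies in one of the factors. -/
theorem exists_mem_factor_of_isReflection {k : ℕ} {H : Fin k → Subgroup W} {K : Subgroup W}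
    (h : Subgroup.IsInternalDirectProduct H K) (hH : ∀ i, cs.IsParabolic (H i)) {t : W}
    (ht : cs.IsReflection t) (htK : t ∈ K) : ∃ i, t ∈ H i := by
  obtain ⟨f, hf, hft⟩ := h.exists_prod_eq htK
  obtain ⟨i, hi⟩ : ∃ i, f i ≠ 1 := by
    by_contra! hcon
    apply ht.ne_one
    rw [← hft]
    exact List.prod_eq_one fun x hx => by
      obtain ⟨i, rfl⟩ := (List.mem_ofFn' _ _).1 hx
      exact hcon i
  refine ⟨i, ?_⟩
  obtain ⟨y, hy, hfy⟩ := Subgroup.exists_prod_ofFn_eq_mul h.1 hf i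
  obtain ⟨g, I, hg⟩ := hH i
  have hfi := hf i
  rw [hg, mem_conjParabolic] at hfi
  -- A nontrivial component moves some root `g α_j` of its own factor, while the other factors fix
  -- it, as their reflections commute with its reflection and differ from it.
  obtain ⟨j, hj, hjne⟩ : ∃ j ∈ I, cs.rep (f i) (cs.rep g (M.simpleRoot j)) ≠
      cs.rep g (M.simpleRoot j) := by
    by_contra! hcon
    apply hi
    have : g⁻¹ * f i * g = 1 := by
      refine cs.eq_one_of_mem_standardParabolic hfi fun j hj => ?_
      rw [rep_mul_apply, rep_mul_apply, hcon j hj, rep_inv_rep]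
      exact M.simpleRoot_nonneg j
    have h2 : g * (g⁻¹ * f i * g) * g⁻¹ = 1 := by rw [this]; group
    rw [← h2]
    group
  have hyfix : y ∈ cs.fixer (cs.rep g (M.simpleRoot j)) := by
    refine (iSup₂_le fun l hl => ?_ : ⨆ l, ⨆ _ : l ≠ i, H l ≤ _) hy
    obtain ⟨z, J, hz⟩ := hH l
    rw [hz, conjParabolic_le_iff]
    intro m hm
    have hzm : z * cs.simple m * z⁻¹ ∈ H l := hz ▸ cs.conj_mem_conjParabolic_of_mem hm
    have hgj : g * cs.simple j * g⁻¹ ∈ H i := hg ▸ cs.conj_mem_conjParabolic_of_mem hj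
    refine cs.rep_conj_simple_eq_self_of_commute (h.commute hl hzm hgj) fun he => ?_
    exact ((cs.isReflection_simple m).conj z).ne_one (h.eq_one_of_mem_of_mem hl hzm (he ▸ hgj))
  obtain ⟨x, m, rfl⟩ := ht
  -- `t` and `f i` displace `g α_j` equally: by a nonzero multiple of the root of `t`, and by a
  -- vector of `g` applied to the span of `I`. So the root of `t` lies in that space.
  have hact := cs.rep_conj_simple x m (cs.rep g (M.simpleRoot j))
  rw [← hft, hfy, rep_mul_apply, cs.mem_fixer.1 hyfix] at hact
  have hmem : cs.rep (g⁻¹ * x) (M.simpleRoot m) ∈ Finsupp.supported ℝ ℝ I := by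
    have h1 := cs.rep_sub_mem_supported hfi (M.simpleRoot j)
    set b := 2 * M.rootForm (cs.rep x (M.simpleRoot m)) (cs.rep g (M.simpleRoot j)) with hb
    have hb0 : b ≠ 0 := by
      intro h0
      rw [h0, zero_smul, sub_zero] at hact
      exact hjne hact
    rw [rep_mul_apply, rep_mul_apply, hact, map_sub, map_smul, rep_inv_rep, sub_sub_cancel_left,
      neg_mem_iff, Submodule.smul_mem_iff _ hb0, ← rep_mul_apply] at h1
    exact h1
  rw [hg, mem_conjParabolic]
  have := cs.conj_simple_mem_standardParabolic hmem
  convert this using 1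
  group

theorem NegatesSimpleRoots.mono {cs : CoxeterSystem M W} {w : W} {I J : Set B}
    (h : cs.NegatesSimpleRoots w I) (hJ : J ⊆ I) : cs.NegatesSimpleRoots w J :=
  fun i hi => h i (hJ hi)

theorem commute_simple_of_eq_two {i j : B} (h : M i j = 2) :
    Commute (cs.simple i) (cs.simple j) := by
  have h1 := cs.simple_mul_simple_pow i j
  rw [h, pow_two] at h1
  have h2 := inv_eq_of_mul_eq_one_right h1
  rw [mul_inv_rev, inv_simple, inv_simple] at h2
  exact h2.symm

theorem standardParabolic_commute {I J : Set B} (h : ∀ i ∈ I, ∀ j ∈ J, M i j = 2) {x y : W}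
    (hx : x ∈ cs.standardParabolic I) (hy : y ∈ cs.standardParabolic J) : Commute x y := by
  have key : cs.standardParabolic I ≤
      Subgroup.centralizer (cs.standardParabolic J : Set W) := by
    rw [Subgroup.le_centralizer_iff, standardParabolic, standardParabolic, Subgroup.closure_le]
    rintro _ ⟨j, hj, rfl⟩
    rw [Subgroup.centralizer_closure, SetLike.mem_coe, Subgroup.mem_centralizer_iff]
    rintro _ ⟨i, hi, rfl⟩
    exact (cs.commute_simple_of_eq_two (h i hi j hj)).eq
  exact (Subgroup.mem_centralizer_iff.1 (key hx) y hy).symm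

theorem conjParabolic_mono (g : W) {I J : Set B} (h : I ⊆ J) :
    cs.conjParabolic g I ≤ cs.conjParabolic g J :=
  cs.conjParabolic_le_iff.2 fun _ hi => cs.conj_mem_conjParabolic_of_mem (h hi)

theorem iSup_conjParabolic_le_fixer {k : ℕ} (g : W) (J : Fin k → Set B)
    (hJ : Pairwise fun a b => ∀ i ∈ J a, ∀ j ∈ J b, M i j = 2) {a : Fin k} {j : B}
    (hj : j ∈ J a) :
    ⨆ b, ⨆ _ : b ≠ a, cs.conjParabolic g (J b) ≤ cs.fixer (cs.rep g (M.simpleRoot j)) := by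
  refine iSup₂_le fun b hb => ?_
  rw [conjParabolic_le_iff]
  intro i hi
  rw [mem_fixer, rep_conj_simple, rootForm_rep,
    M.rootForm_simpleRoot_eq_zero_iff.2 (hJ hb i hi j hj)]
  simp

/-- A parabolic subgroup whose type splits into mutually orthogonal pieces is the internal direct
product of the corresponding parabolic subgroups. -/
theorem isInternalDirectProduct_conjParabolic {k : ℕ} (g : W) (J : Fin k → Set B)
    (hJ : Pairwise fun a b => ∀ i ∈ J a, ∀ j ∈ J b, M i j = 2) :
    Subgroup.IsInternalDirectProduct (fun a => cs.conjParabolic g (J a))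
      (cs.conjParabolic g (⋃ a, J a)) := by
  have hcomm : Pairwise fun a b => ∀ x y : W, x ∈ cs.conjParabolic g (J a) →
      y ∈ cs.conjParabolic g (J b) → Commute x y := by
    intro a b hab x y hx hy
    rw [mem_conjParabolic] at hx hy
    have := (cs.standardParabolic_commute (hJ hab) hx hy).map (MulAut.conj g)
    simpa [mul_assoc] using this
  refine ⟨hcomm, ?_, ?_⟩
  · rw [injective_iff_map_eq_one]
    intro f hf
    funext a
    obtain ⟨y, hy, hfy⟩ := Subgroup.exists_prod_ofFn_eq_mul hcomm (fun i => (f i).2) a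
    rw [← Subgroup.noncommPiCoprod_eq_prod_ofFn hcomm, hf] at hfy
    have hfa := cs.mem_conjParabolic.1 (f a).2
    have h1 : g⁻¹ * f a * g = 1 := by
      -- `f a` is the inverse of a product of the other factors, hence fixes all roots `g α_j` with
      -- `j ∈ J a`.
      refine cs.eq_one_of_mem_standardParabolic hfa fun j hj => ?_
      have hfix : y ∈ cs.fixer (cs.rep g (M.simpleRoot j)) := by
        exact cs.iSup_conjParabolic_le_fixer g J hJ hj hy
      have h2 : (f a : W) ∈ cs.fixer (cs.rep g (M.simpleRoot j)) := by
        rw [← inv_mem_iff, inv_eq_of_mul_eq_one_right hfy.symm]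
        exact hfix
      rw [rep_mul_apply, rep_mul_apply, cs.mem_fixer.1 h2, rep_inv_rep]
      exact M.simpleRoot_nonneg j
    rw [mul_assoc, inv_mul_eq_one] at h1
    exact Subtype.ext (right_eq_mul.1 h1)
  · rw [Subgroup.noncommPiCoprod_range]
    refine le_antisymm (iSup_le fun a => cs.conjParabolic_mono g (Set.subset_iUnion J a)) ?_
    rw [conjParabolic_le_iff]
    intro i hi
    obtain ⟨a, ha⟩ := Set.mem_iUnion.1 hi
    exact (le_iSup (fun a => cs.conjParabolic g (J a)) a) (cs.conj_mem_conjParabolic_of_mem ha)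

end CoxeterSystem

/-! ### Existence of the decomposition -/

/-- The vertex set of a component of an induced subgraph induces a connected subgraph. -/
theorem SimpleGraph.ConnectedComponent.connected_induce_image_supp {V : Type*} {G : SimpleGraph V}
    {I : Set V} (c : (G.induce I).ConnectedComponent) :
    (G.induce ((↑) '' c.supp : Set V)).Connected := by
  have e : c.toSimpleGraph ≃g G.induce ((↑) '' c.supp : Set V) :=
    { Equiv.Set.image _ c.supp Subtype.val_injective with
      map_rel_iff' := Iff.rfl }
  exact e.connected_iff.1 c.connected_toSimpleGraph

namespace CoxeterSystem

variable {B W : Type*} [Group W] {M : CoxeterMatrix B} (cs : CoxeterSystem M W)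

/-- An involution decomposes along the connected components of the type of its parabolic closure. -/
theorem exists_isInvolutionDecomposition {u : W} (hu : u ^ 2 = 1) :
    ∃ (k : ℕ) (v : Fin k → W), cs.IsInvolutionDecomposition u v := by
  obtain ⟨g, w, I, rfl, hI, -, hw, hneg⟩ := cs.exists_conj_negatesSimpleRoots hu
  have := hI.to_subtype
  let C := (M.coxeterGraph.induce I).ConnectedComponent
  have : Finite C := Quot.finite _
  obtain ⟨k, ⟨e⟩⟩ := Finite.exists_equiv_fin C
  let J : Fin k → Set B := fun a => (↑) '' (e.symm a).supp
  have hJI : ∀ a, J a ⊆ I := by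
    rintro a _ ⟨i, -, rfl⟩
    exact i.2
  have hJU : ⋃ a, J a = I := by
    refine (Set.iUnion_subset hJI).antisymm fun i hi => Set.mem_iUnion.2 ?_
    exact ⟨e ((M.coxeterGraph.induce I).connectedComponentMk ⟨i, hi⟩), ⟨i, hi⟩, by simp, rfl⟩
  have hJ : Pairwise fun a b => ∀ i ∈ J a, ∀ j ∈ J b, M i j = 2 := by
    rintro a b hab _ ⟨i, hi, rfl⟩ _ ⟨j, hj, rfl⟩
    by_contra hne
    rw [SimpleGraph.ConnectedComponent.mem_supp_iff] at hi hj
    have hij : i ≠ j := by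
      rintro rfl
      exact hab (e.symm.injective (hi.symm.trans hj))
    have hadj : (M.coxeterGraph.induce I).Adj i j := ⟨fun h => hij (Subtype.ext h), hne⟩
    have := SimpleGraph.ConnectedComponent.connectedComponentMk_eq_of_adj hadj
    rw [hi, hj] at this
    exact hab (e.symm.injective this)
  have hprod := cs.isInternalDirectProduct_conjParabolic g J hJ
  rw [hJU, ← hneg.parabolicClosure_conj hw] at hprod
  obtain ⟨v, hv, hvu⟩ := hprod.exists_prod_eq (cs.mem_parabolicClosure _)
  -- The other components fix the roots of piece `a`, so there `v a` acts like `u`, that is, as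
  -- `-1`.
  have hvneg : ∀ a, cs.NegatesSimpleRoots (g⁻¹ * v a * g) (J a) := by
    intro a j hj
    obtain ⟨y, hy, hvy⟩ := Subgroup.exists_prod_ofFn_eq_mul hprod.1 hv a
    have hfix := cs.mem_fixer.1 (cs.iSup_conjParabolic_le_fixer g J hJ hj hy)
    have h1 : cs.rep (v a) (cs.rep g (M.simpleRoot j)) =
        cs.rep (g * w * g⁻¹) (cs.rep g (M.simpleRoot j)) := by
      rw [← hvu, hvy, rep_mul_apply, hfix]
    rw [rep_mul_apply, rep_mul_apply, h1, ← rep_mul_apply, ← rep_mul_apply,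
      show g⁻¹ * (g * w * g⁻¹) * g = w by group]
    exact hneg.mono (hJI a) j hj
  have hclos : (fun a => cs.parabolicClosure (v a)) = fun a => cs.conjParabolic g (J a) := by
    funext a
    rw [← (hvneg a).parabolicClosure_conj (g := g) (cs.mem_conjParabolic.1 (hv a))]
    congr 1
    group
  refine ⟨k, v, ?_, ?_, hvu, fun a => ?_, hclos ▸ hprod⟩
  · have hone : (List.ofFn fun a : Fin k => v a * v a).prod = (List.ofFn fun _ : Fin k => 1).prod := by
      rw [hprod.prod_mul hv hv, hvu, ← pow_two, hu]
      simp
    have := hprod.prod_injective (fun a => mul_mem (hv a) (hv a)) (fun _ => one_mem _) hone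
    intro a
    rw [pow_two]
    exact congrFun this a
  · intro a b
    rcases eq_or_ne a b with rfl | hab
    · exact Commute.refl _
    · exact hprod.commute hab (hv a) (hv b)
  · exact ⟨g, J a, congrFun hclos a, (e.symm a).connected_induce_image_supp⟩

/-! ### Uniqueness of the decomposition -/

variable {cs}

theorem IsIrreducibleParabolic.isParabolic {P : Subgroup W} (h : cs.IsIrreducibleParabolic P) :
    cs.IsParabolic P := by
  obtain ⟨g, I, hP, -⟩ := h
  exact ⟨g, I, hP⟩

theorem IsIrreducibleParabolic.exists_ne_one {P : Subgroup W} (h : cs.IsIrreducibleParabolic P) :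
    ∃ x ∈ P, x ≠ 1 := by
  obtain ⟨g, I, rfl, hI⟩ := h
  obtain ⟨i, hi⟩ := hI.nonempty
  exact ⟨_, cs.conj_mem_conjParabolic_of_mem hi, ((cs.isReflection_simple i).conj g).ne_one⟩

/-- An irreducible parabolic subgroup of an internal direct product of parabolic subgroups is
contained in one of the factors. -/
theorem IsIrreducibleParabolic.exists_le_factor {P : Subgroup W}
    (hP : cs.IsIrreducibleParabolic P) {k : ℕ} {H : Fin k → Subgroup W} {K : Subgroup W}
    (h : Subgroup.IsInternalDirectProduct H K) (hH : ∀ i, cs.IsParabolic (H i)) (hPK : P ≤ K) :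
    ∃ i, P ≤ H i := by
  obtain ⟨g, I, rfl, hI⟩ := hP
  have key : ∀ i : I, ∃ a, g * cs.simple i * g⁻¹ ∈ H a := fun i =>
    cs.exists_mem_factor_of_isReflection h hH ((cs.isReflection_simple i).conj g)
      (hPK (cs.conj_mem_conjParabolic_of_mem i.2))
  choose c hc using key
  -- Reflections in different factors commute, whereas adjacent simple reflections do not; so `c` is
  -- constant on the connected graph.
  have hadj : ∀ i j, (M.coxeterGraph.induce I).Adj i j → c i = c j := by
    intro i j hij
    by_contra hne
    have hcomm := (h.commute hne (hc i) (hc j)).map (MulAut.conj g⁻¹)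
    have hcomm' : Commute (cs.simple i) (cs.simple j) := by
      simpa [mul_assoc] using hcomm
    exact hij.2 (cs.eq_two_of_commute_simple hij.1 hcomm')
  have hreach : ∀ i j, (M.coxeterGraph.induce I).Reachable i j → c i = c j := by
    rintro i j ⟨p⟩
    induction p with
    | nil => rfl
    | cons hij _ ih => exact (hadj _ _ hij).trans ih
  obtain ⟨i₀⟩ := hI.nonempty
  refine ⟨c i₀, cs.conjParabolic_le_iff.2 fun i hi => ?_⟩
  rw [hreach i₀ ⟨i, hi⟩ (hI.preconnected _ _)]
  exact hc ⟨i, hi⟩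

theorem _root_.Subgroup.IsInternalDirectProduct.eq_of_le {G : Type*} [Group G] {k : ℕ}
    {H : Fin k → Subgroup G} {K : Subgroup G} (h : Subgroup.IsInternalDirectProduct H K)
    {i j : Fin k} (hi : ∃ x ∈ H i, x ≠ 1) (hij : H i ≤ H j) : i = j := by
  obtain ⟨x, hx, hx1⟩ := hi
  by_contra hne
  exact hx1 (h.eq_one_of_mem_of_mem hne hx (hij hx))

theorem IsInvolutionDecomposition.exists_le {u : W} {k l : ℕ} {v : Fin k → W} {v' : Fin l → W}
    (h : cs.IsInvolutionDecomposition u v) (h' : cs.IsInvolutionDecomposition u v') (i : Fin k) :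
    ∃ j, cs.parabolicClosure (v i) ≤ cs.parabolicClosure (v' j) :=
  (h.irreducible i).exists_le_factor h'.directProduct (fun j => (h'.irreducible j).isParabolic)
    (h.directProduct.le i)

/-- Each factor of one decomposition lies in a factor of the other. Going back and forth puts a
nontrivial factor inside a factor of the same product, hence inside itself; so the factors match,
and with them the components of `u`. -/
theorem IsInvolutionDecomposition.unique {u : W} {k l : ℕ} {v : Fin k → W} {v' : Fin l → W}
    (h : cs.IsInvolutionDecomposition u v) (h' : cs.IsInvolutionDecomposition u v') :
    ∃ σ : Fin k ≃ Fin l, ∀ i, v i = v' (σ i) := by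
  choose f hf using h.exists_le h'
  choose f' hf' using h'.exists_le h
  have hleft : ∀ i, f' (f i) = i := fun i =>
    (h.directProduct.eq_of_le (h.irreducible i).exists_ne_one ((hf i).trans (hf' (f i)))).symm
  have hright : ∀ j, f (f' j) = j := fun j =>
    (h'.directProduct.eq_of_le (h'.irreducible j).exists_ne_one ((hf' j).trans (hf (f' j)))).symm
  refine ⟨⟨f, f', hleft, hright⟩, ?_⟩
  refine h.directProduct.component_unique h'.directProduct _ (fun i => ?_)
    (fun i => cs.mem_parabolicClosure _) (fun j => cs.mem_parabolicClosure _)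
    (h.prod_eq.trans h'.prod_eq.symm)
  refine le_antisymm (hf i) ?_
  have := hf' (f i)
  rwa [hleft] at this

/-! ### The absolute order below an involution -/

variable (cs) in
theorem reflectionLength_prod_ofFn_le {k : ℕ} (f : Fin k → W) :
    cs.reflectionLength (List.ofFn f).prod ≤ ∑ i, cs.reflectionLength (f i) := by
  induction k with
  | zero => simp [reflectionLength_one]
  | succ k ih =>
    rw [List.ofFn_succ, List.prod_cons, Fin.sum_univ_succ]
    exact (cs.reflectionLength_mul_le _ _).trans (Nat.add_le_add_left (ih _) _)

variable (cs) in
/-- Sorting a product of reflections by the factors of an internal direct product. -/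
theorem exists_components_of_reflectionWord {k : ℕ} {H : Fin k → Subgroup W} {K : Subgroup W}
    (h : Subgroup.IsInternalDirectProduct H K) (hH : ∀ i, cs.IsParabolic (H i)) (l : List W)
    (hl : ∀ t ∈ l, cs.IsReflection t) (hlK : ∀ t ∈ l, t ∈ K) :
    ∃ f : Fin k → W, (∀ i, f i ∈ H i) ∧ (List.ofFn f).prod = l.prod ∧
      ∑ i, cs.reflectionLength (f i) ≤ l.length := by
  induction l with
  | nil => exact ⟨fun _ => 1, fun _ => one_mem _, by simp, by simp [reflectionLength_one]⟩
  | cons t l ih =>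
    obtain ⟨f, hf, hfl, hflen⟩ := ih (fun s hs => hl s (List.mem_cons_of_mem _ hs))
      (fun s hs => hlK s (List.mem_cons_of_mem _ hs))
    have ht := hl t List.mem_cons_self
    obtain ⟨i, hi⟩ := cs.exists_mem_factor_of_isReflection h hH ht (hlK t List.mem_cons_self)
    have hs := Subgroup.IsInternalDirectProduct.mulSingle_mem hi
    refine ⟨fun j => Pi.mulSingle (M := fun _ => W) i t j * f j, fun j => mul_mem (hs j) (hf j),
      ?_, ?_⟩
    · rw [h.prod_mul hs hf, hfl, h.prod_mulSingle hi, List.prod_cons]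
    · have h1 : ∑ j, cs.reflectionLength (Pi.mulSingle (M := fun _ => W) i t j) =
          cs.reflectionLength t := by
        rw [Finset.sum_eq_single i, Pi.mulSingle_eq_same]
        · intro j _ hj
          rw [Pi.mulSingle_eq_of_ne hj, reflectionLength_one]
        · simp
      have h2 := cs.reflectionLength_prod_le [t] (by simpa using ht)
      rw [List.prod_singleton, List.length_singleton] at h2
      calc _ ≤ ∑ j, (cs.reflectionLength (Pi.mulSingle (M := fun _ => W) i t j) +
            cs.reflectionLength (f j)) :=
            Finset.sum_le_sum fun j _ => cs.reflectionLength_mul_le _ _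
        _ ≤ (t :: l).length := by
          rw [Finset.sum_add_distrib, h1, List.length_cons]
          omega

-- Three factors encode a chain `x ≤ y ≤ u` as `u = x · x⁻¹y · y⁻¹u`. Their shortest reflection
-- words concatenate to a shortest one for `u`, which is what puts all letters into `P(u)`.
variable (cs) in
theorem exists_components_of_mul_mul {u : W} (hu : u ^ 2 = 1) {k : ℕ} {H : Fin k → Subgroup W}
    (h : Subgroup.IsInternalDirectProduct H (cs.parabolicClosure u))
    (hH : ∀ i, cs.IsParabolic (H i)) {a b c : W} (habc : a * b * c = u)
    (hlen : cs.reflectionLength a + cs.reflectionLength b + cs.reflectionLength c =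
      cs.reflectionLength u) :
    ∃ f₁ f₂ f₃ : Fin k → W, ((∀ i, f₁ i ∈ H i) ∧ (∀ i, f₂ i ∈ H i) ∧ (∀ i, f₃ i ∈ H i)) ∧
      ((List.ofFn f₁).prod = a ∧ (List.ofFn f₂).prod = b ∧ (List.ofFn f₃).prod = c) ∧
      ∑ i, (cs.reflectionLength (f₁ i) + cs.reflectionLength (f₂ i) +
        cs.reflectionLength (f₃ i)) ≤ cs.reflectionLength u := by
  obtain ⟨l₁, hl₁, hr₁, rfl⟩ := cs.exists_reflectionWord a
  obtain ⟨l₂, hl₂, hr₂, rfl⟩ := cs.exists_reflectionWord b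
  obtain ⟨l₃, hl₃, hr₃, rfl⟩ := cs.exists_reflectionWord c
  have hmem : ∀ t ∈ l₁ ++ l₂ ++ l₃, t ∈ cs.parabolicClosure u := by
    intro t ht
    refine cs.mem_parabolicClosure_of_mem_reflectionWord hu ?_ ?_ ?_ ht
    · intro s hs
      rcases List.mem_append.1 hs with hs | hs
      · rcases List.mem_append.1 hs with hs | hs
        exacts [hr₁ s hs, hr₂ s hs]
      · exact hr₃ s hs
    · rw [List.prod_append, List.prod_append, habc]
    · rw [List.length_append, List.length_append, hl₁, hl₂, hl₃, hlen]
  obtain ⟨f₁, h₁, e₁, s₁⟩ := cs.exists_components_of_reflectionWord h hH l₁ hr₁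
    fun t ht => hmem t (by simp [ht])
  obtain ⟨f₂, h₂, e₂, s₂⟩ := cs.exists_components_of_reflectionWord h hH l₂ hr₂
    fun t ht => hmem t (by simp [ht])
  obtain ⟨f₃, h₃, e₃, s₃⟩ := cs.exists_components_of_reflectionWord h hH l₃ hr₃
    fun t ht => hmem t (by simp [ht])
  refine ⟨f₁, f₂, f₃, ⟨h₁, h₂, h₃⟩, ⟨e₁, e₂, e₃⟩, ?_⟩
  rw [Finset.sum_add_distrib, Finset.sum_add_distrib]
  omega

theorem absLE_one (w : W) : cs.AbsLE 1 w := by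
  simp [AbsLE, reflectionLength_one]

theorem IsInvolutionDecomposition.sum_reflectionLength {u : W} (hu : u ^ 2 = 1) {k : ℕ}
    {v : Fin k → W} (h : cs.IsInvolutionDecomposition u v) :
    ∑ i, cs.reflectionLength (v i) = cs.reflectionLength u := by
  apply le_antisymm
  · obtain ⟨f₁, f₂, f₃, ⟨h₁, h₂, h₃⟩, ⟨e₁, -, -⟩, hs⟩ := cs.exists_components_of_mul_mul hu
      h.directProduct (fun i => (h.irreducible i).isParabolic) (a := u) (b := 1) (c := 1) (by simp)
      (by simp [reflectionLength_one])
    have := h.directProduct.prod_injective h₁ (fun i => cs.mem_parabolicClosure (v i))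
      (e₁.trans h.prod_eq.symm)
    subst this
    refine le_trans (Finset.sum_le_sum fun i _ => ?_) hs
    omega
  · have := cs.reflectionLength_prod_ofFn_le v
    rwa [h.prod_eq] at this

/-- Elements below an involution lie in its parabolic closure. -/
theorem AbsLE.mem_parabolicClosure {u x : W} (hu : u ^ 2 = 1) (hx : cs.AbsLE x u) :
    x ∈ cs.parabolicClosure u := by
  obtain ⟨l, hl, hr, rfl⟩ := cs.exists_reflectionWord x
  obtain ⟨m, hm, hs, he⟩ := cs.exists_reflectionWord (l.prod⁻¹ * u)
  refine list_prod_mem fun t ht => ?_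
  refine cs.mem_parabolicClosure_of_mem_reflectionWord hu (l := l ++ m) ?_ ?_ ?_ (by simp [ht])
  · intro s hs'
    rcases List.mem_append.1 hs' with h | h
    exacts [hr s h, hs s h]
  · rw [List.prod_append, he, mul_inv_cancel_left]
  · rw [List.length_append, hl, hm]
    exact hx

/-- The chain `∏ xᵢ ≤ ∏ yᵢ ≤ u` for the absolute order may be tested componentwise. -/
theorem IsInvolutionDecomposition.absLE_chain_iff {u : W} (hu : u ^ 2 = 1) {k : ℕ}
    {v : Fin k → W} (h : cs.IsInvolutionDecomposition u v) {x y : Fin k → W}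
    (hx : ∀ i, x i ∈ cs.parabolicClosure (v i)) (hy : ∀ i, y i ∈ cs.parabolicClosure (v i)) :
    (cs.AbsLE (List.ofFn x).prod (List.ofFn y).prod ∧ cs.AbsLE (List.ofFn y).prod u) ↔
      ∀ i, cs.AbsLE (x i) (y i) ∧ cs.AbsLE (y i) (v i) := by
  have hv : ∀ i, v i ∈ cs.parabolicClosure (v i) := fun i => cs.mem_parabolicClosure (v i)
  have hxy : ∀ i, (x i)⁻¹ * y i ∈ cs.parabolicClosure (v i) :=
    fun i => mul_mem (inv_mem (hx i)) (hy i)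
  have hyv : ∀ i, (y i)⁻¹ * v i ∈ cs.parabolicClosure (v i) :=
    fun i => mul_mem (inv_mem (hy i)) (hv i)
  have e₁ : (List.ofFn fun i => (x i)⁻¹ * y i).prod = (List.ofFn x).prod⁻¹ * (List.ofFn y).prod := by
    rw [h.directProduct.prod_mul (fun i => inv_mem (hx i)) hy, h.directProduct.prod_inv hx]
  have e₂ : (List.ofFn fun i => (y i)⁻¹ * v i).prod = (List.ofFn y).prod⁻¹ * u := by
    rw [h.directProduct.prod_mul (fun i => inv_mem (hy i)) hv, h.directProduct.prod_inv hy,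
      h.prod_eq]
  have hsum := h.sum_reflectionLength hu
  have t₁ : ∀ i, cs.reflectionLength (y i) ≤
      cs.reflectionLength (x i) + cs.reflectionLength ((x i)⁻¹ * y i) := fun i => by
    simpa using cs.reflectionLength_mul_le (x i) ((x i)⁻¹ * y i)
  have t₂ : ∀ i, cs.reflectionLength (v i) ≤
      cs.reflectionLength (y i) + cs.reflectionLength ((y i)⁻¹ * v i) := fun i => by
    simpa using cs.reflectionLength_mul_le (y i) ((y i)⁻¹ * v i)
  constructor
  · rintro ⟨h₁, h₂⟩
    obtain ⟨f₁, f₂, f₃, ⟨m₁, m₂, m₃⟩, ⟨p₁, p₂, p₃⟩, hs⟩ := cs.exists_components_of_mul_mul hu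
      h.directProduct (fun i => (h.irreducible i).isParabolic) (a := (List.ofFn x).prod)
      (b := (List.ofFn x).prod⁻¹ * (List.ofFn y).prod) (c := (List.ofFn y).prod⁻¹ * u)
      (by group) (by
        unfold AbsLE at h₁ h₂
        omega)
    obtain rfl := h.directProduct.prod_injective m₁ hx p₁
    obtain rfl := h.directProduct.prod_injective m₂ hxy (p₂.trans e₁.symm)
    obtain rfl := h.directProduct.prod_injective m₃ hyv (p₃.trans e₂.symm)
    -- The triangle inequality bounds each summand below by `ℓ_T(v i)`, and the sums agree, so
    -- equality holds for every `i`.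
    have hle : ∀ i ∈ Finset.univ, cs.reflectionLength (v i) ≤ cs.reflectionLength (f₁ i) +
        cs.reflectionLength ((f₁ i)⁻¹ * y i) + cs.reflectionLength ((y i)⁻¹ * v i) := fun i _ => by
      have := t₁ i
      have := t₂ i
      omega
    have heq := (Finset.sum_eq_sum_iff_of_le hle).1
      (le_antisymm (Finset.sum_le_sum hle) (hs.trans_eq hsum.symm))
    intro i
    have := heq i (Finset.mem_univ i)
    have := t₁ i
    have := t₂ i
    unfold AbsLE
    omega
  · intro hall
    -- Subadditivity gives this bound; the triangle inequalities then turn both steps of the chain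
    -- into equalities.
    have hle : cs.reflectionLength (List.ofFn x).prod +
        cs.reflectionLength ((List.ofFn x).prod⁻¹ * (List.ofFn y).prod) +
        cs.reflectionLength ((List.ofFn y).prod⁻¹ * u) ≤ cs.reflectionLength u := by
      have s₁ := cs.reflectionLength_prod_ofFn_le x
      have s₂ := cs.reflectionLength_prod_ofFn_le fun i => (x i)⁻¹ * y i
      have s₃ := cs.reflectionLength_prod_ofFn_le fun i => (y i)⁻¹ * v i
      rw [e₁] at s₂
      rw [e₂] at s₃
      have hs : ∑ i, cs.reflectionLength (v i) = ∑ i, (cs.reflectionLength (x i) +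
          cs.reflectionLength ((x i)⁻¹ * y i) + cs.reflectionLength ((y i)⁻¹ * v i)) := by
        refine Finset.sum_congr rfl fun i _ => ?_
        obtain ⟨h₁, h₂⟩ := hall i
        unfold AbsLE at h₁ h₂
        omega
      rw [Finset.sum_add_distrib, Finset.sum_add_distrib] at hs
      omega
    have q₁ := cs.reflectionLength_mul_le (List.ofFn x).prod
      ((List.ofFn x).prod⁻¹ * (List.ofFn y).prod)
    have q₂ := cs.reflectionLength_mul_le (List.ofFn y).prod ((List.ofFn y).prod⁻¹ * u)
    rw [mul_inv_cancel_left] at q₁ q₂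
    unfold AbsLE
    omega

theorem IsInvolutionDecomposition.exists_orderIso {u : W} (hu : u ^ 2 = 1) {k : ℕ}
    {v : Fin k → W} (h : cs.IsInvolutionDecomposition u v) :
    ∃ e : (∀ i, cs.AbsInterval 1 (v i)) ≃o cs.AbsInterval 1 u,
      ∀ x, (e x).1 = (List.ofFn fun i => (x i).1).prod := by
  have hmem : ∀ (x : ∀ i, cs.AbsInterval 1 (v i)) i, (x i).1 ∈ cs.parabolicClosure (v i) :=
    fun x i => AbsLE.mem_parabolicClosure (h.sq_eq_one i) (x i).2.2
  let F : (∀ i, cs.AbsInterval 1 (v i)) → cs.AbsInterval 1 u := fun x =>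
    ⟨(List.ofFn fun i => (x i).1).prod, absLE_one _,
      ((h.absLE_chain_iff hu (hmem x) (hmem x)).2
        fun i => ⟨AbsLE.rfl cs _, (x i).2.2⟩).2⟩
  -- The chain criterion applies because the upper step `y ≤ u` is automatic inside the intervals.
  have hF : ∀ x y, F x ≤ F y ↔ x ≤ y := by
    intro x y
    constructor
    · intro hxy i
      exact ((h.absLE_chain_iff hu (hmem x) (hmem y)).1 ⟨hxy, (F y).2.2⟩ i).1
    · intro hxy
      exact ((h.absLE_chain_iff hu (hmem x) (hmem y)).2 fun i => ⟨hxy i, (y i).2.2⟩).1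
  have hsurj : Function.Surjective F := by
    rintro ⟨y, hy₁, hy⟩
    obtain ⟨f, hf, rfl⟩ := h.directProduct.exists_prod_eq (AbsLE.mem_parabolicClosure hu hy)
    have := (h.absLE_chain_iff hu hf hf).1 ⟨AbsLE.rfl cs _, hy⟩
    exact ⟨fun i => ⟨f i, absLE_one _, (this i).2⟩, rfl⟩
  exact ⟨RelIso.ofSurjective (OrderEmbedding.ofMapLEIff F hF) hsurj, fun x => rfl⟩

end CoxeterSystem

theorem mainTheorem7 {B W : Type*} [Group W] {M : CoxeterMatrix B} (cs : CoxeterSystem M W)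
    (u : W) (hu : u ^ 2 = 1) :
    IsLeast {P : Subgroup W | cs.IsParabolic P ∧ u ∈ P} (cs.parabolicClosure u) ∧
    Finite (cs.parabolicClosure u) ∧
    (∃ (k : ℕ) (v : Fin k → W), cs.IsInvolutionDecomposition u v) ∧
    (∀ (k l : ℕ) (v : Fin k → W) (v' : Fin l → W),
      cs.IsInvolutionDecomposition u v → cs.IsInvolutionDecomposition u v' →
        ∃ σ : Fin k ≃ Fin l, ∀ i, v i = v' (σ i)) ∧
    (∀ (k : ℕ) (v : Fin k → W), cs.IsInvolutionDecomposition u v →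
      ∃ e : (∀ i, cs.AbsInterval 1 (v i)) ≃o cs.AbsInterval 1 u,
        ∀ x, (e x).1 = (List.ofFn fun i => (x i).1).prod) := by
  obtain ⟨g, w, I, hgw, -, hfin, hw, hneg⟩ := cs.exists_conj_negatesSimpleRoots hu
  have hP : cs.parabolicClosure u = cs.conjParabolic g I := by
    rw [hgw, hneg.parabolicClosure_conj hw]
  refine ⟨⟨⟨⟨g, I, hP⟩, cs.mem_parabolicClosure u⟩, fun P hPu => sInf_le hPu⟩, ?_,
    cs.exists_isInvolutionDecomposition hu, fun k l v v' h h' => h.unique h',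
    fun k v h => h.exists_orderIso hu⟩
  rw [hP]
  exact Set.Finite.to_subtype ((Set.toFinite (cs.standardParabolic I : Set W)).image _)
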